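/- Let $K$ be a field, let $n\ge 0$, and let ${\bf w}_1\le {\bf w}_2\le\cdots\le {\bf w}_n$ be positive integers. Let $P_{\bf w}^{n+1}$ be the increasing weighted path with vertices $x_1,\ldots,x_{n+1}$ and edges $e_i=x_ix_{i+1}$ of weight ${\bf w}_i$ ($1\le i\le n$), let $S=K[x_1,\ldots,x_{n+1}]$, and let $$I(P_{\bf w}^{n+1})=\bigl((x_ix_{i+1})^{{\bf w}_i} \mid 1\le i\le n\bigr)\subseteq S$$ be its edge ideal. Let $$\Delta=\{\, i \mid 1\le i\le n-2,\ {\bf w}_i={\bf w}_{i+1}\,\}.$$ Write $\Delta$ as the disjoint union of its maximal blocks of consecutive integers. A block $\delta$ has type $j\in\{0,1,2\}$ if $|\delta|\equiv j \pmod 3$. Two successive blocks $[p_1,q_1]$, $[p_2,q_2]$ (with $q_1<p_2$) are gluable if neither has type $0$ and $p_2-q_1=2$. Let $\Delta=\Delta_1\cup\cdots\cup\Delta_q$ be the resulting decomposition, in which each $\Delta_i$ is either a block of type $0$ or the union of a maximal run of successive blocks of type $1$ or $2$ in which any two neighbours are gluable. For each $i$ let $t_i$ and $s_i$ be the numbers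 of blocks of type $1$ and of type $2$ in $\Delta_i$, let $r_i\in\{0,1\}$ be the residue of $t_i$ modulo $2$, and put $$a(\Delta)=\sum_{i=1}^q r_i,\qquad b(\Delta)=\sum_{i=1}^q s_i+\sum_{i=1}^q\frac{t_i-r_i}{2},\qquad c(\Delta)=\frac{|\Delta|-a(\Delta)-2b(\Delta)}{3},$$ and $k(\Delta)=a(\Delta)+b(\Delta)+c(\Delta)$. Then $$\operatorname{depth}\bigl(S/I(P_{\bf w}^{n+1})\bigr)=k(\Delta)+1,$$ where $\operatorname{depth}$ is the depth with respect to the graded maximal ideal $\mathfrak m=(x_1,\ldots,x_{n+1})$, that is, the maximal length of an $S/I(P_{\bf w}^{n+1})$-regular sequence in $\mathfrak m$ (equivalently, the least $i$ with $H^i_{\mathfrak m}(S/I(P_{\bf w}^{n+1}))\ne 0$). -/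

import Mathlib

noncomputable section

/-- The depth of an `R`-module `M` with respect to an ideal `J`: the supremum of the lengths of
the `M`-regular sequences whose entries lie in `J`. -/
def depthAt {R : Type*} [CommRing R] (J : Ideal R) (M : Type*) [AddCommGroup M] [Module R M] :
    ℕ∞ :=
  ⨆ rs : {rs : List R // (∀ r ∈ rs, r ∈ J) ∧ RingTheory.Sequence.IsRegular M rs},
    (rs.1.length : ℕ∞)

/-- The graded maximal ideal `(x_1, …, x_m)` of `K[x_1, …, x_m]`. -/
def gradedMaximalIdeal (K : Type*) [Field K] (m : ℕ) : Ideal (MvPolynomial (Fin m) K) :=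
  Ideal.span (Set.range MvPolynomial.X)

/-- The edge ideal of the weighted path on the vertices `x_1, …, x_{n+1}` with edges
`e_i = x_i x_{i+1}` of weight `w i`, for `1 ≤ i ≤ n`. The variable `x_i` is `X` at the element
`i - 1` of `Fin (n + 1)`, so the summation index `j : Fin n` below stands for `i = j + 1`. -/
def pathEdgeIdeal (K : Type*) [Field K] (n : ℕ) (w : ℕ → ℕ) :
    Ideal (MvPolynomial (Fin (n + 1)) K) :=
  Ideal.span (Set.range fun j : Fin n =>
    (MvPolynomial.X j.castSucc * MvPolynomial.X j.succ) ^ w (j + 1))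

end

/-- `Δ = {i ∈ [n - 2] : w(e_i) = w(e_{i+1})}`. -/
def pathDelta (n : ℕ) (w : ℕ → ℕ) : Finset ℕ :=
  (Finset.Icc 1 (n - 2)).filter fun i => w i = w (i + 1)

namespace BlockDecomposition

/-- The maximal blocks of `T`, from left to right, each given as the increasing list of its
elements: the elements of `T` in increasing order are cut between two neighbours exactly when
these are not consecutive integers. -/
def blocks (T : Finset ℕ) : List (List ℕ) :=
  (T.sort (· ≤ ·)).splitBy fun x y => decide (y = x + 1)

/-- The type of a block: its cardinality modulo `3`. -/
def blockType (δ : List ℕ) : ℕ := δ.length % 3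

/-- Two successive blocks `[p₁, q₁]` and `[p₂, q₂]` are gluable if neither has type `0` and
`p₂ - q₁ = 2`. (The default values play no role, since an empty list has type `0`.) -/
def Gluable (δ ε : List ℕ) : Prop :=
  blockType δ ≠ 0 ∧ blockType ε ≠ 0 ∧ ε.headD 0 = δ.getLastD 0 + 2

instance (δ ε : List ℕ) : Decidable (Gluable δ ε) :=
  inferInstanceAs (Decidable (_ ∧ _ ∧ _))

/-- The pieces `Δ_1, …, Δ_q` of `T`, each given as the list of its maximal blocks: the list of
maximal blocks is cut between two neighbours exactly when these are not gluable. A piece is thus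
either a single block of type `0` or a maximal extended block. -/
def pieces (T : Finset ℕ) : List (List (List ℕ)) :=
  (blocks T).splitBy fun δ ε => decide (Gluable δ ε)

/-- The number of blocks of type `j` in a piece. -/
def numType (j : ℕ) (D : List (List ℕ)) : ℕ := D.countP fun δ => decide (blockType δ = j)

/-- `r_i`: the residue modulo `2` of the number `t_i` of blocks of type `1`. -/
def residue (D : List (List ℕ)) : ℕ := numType 1 D % 2

/-- `a = ∑ r_i`. -/
def a (T : Finset ℕ) : ℕ := ((pieces T).map residue).sum

/-- `b = ∑ s_i + ∑ (t_i - r_i) / 2`. -/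
def b (T : Finset ℕ) : ℕ :=
  ((pieces T).map (numType 2)).sum + ((pieces T).map fun D => (numType 1 D - residue D) / 2).sum

/-- `c = (|T| - a - 2 b) / 3`; the subtraction and the division are exact, see
`a_add_two_b_add_three_c`. -/
def c (T : Finset ℕ) : ℕ := (T.card - a T - 2 * b T) / 3

/-- `k = a + b + c`. -/
def k (T : Finset ℕ) : ℕ := a T + b T + c T

theorem a_add_two_b_add_three_c (T : Finset ℕ) : a T + 2 * b T + 3 * c T = T.card := by
  have piece : ∀ D : List (List ℕ), ∃ m, numType 1 D + 2 * numType 2 D + 3 * m = D.flatten.length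
    := by
    intro D
    induction D with
    | nil => exact ⟨0, rfl⟩
    | cons δ D ih =>
      obtain ⟨m, hm⟩ := ih
      refine ⟨m + δ.length / 3, ?_⟩
      have hδ : blockType δ = δ.length % 3 := rfl
      simp only [numType, List.countP_cons, List.flatten_cons, List.length_append,
        decide_eq_true_eq] at hm ⊢
      split_ifs <;> omega
  have total : ∀ P : List (List (List ℕ)), ∃ m,
      (P.map residue).sum + 2 * ((P.map (numType 2)).sum +
        (P.map fun D => (numType 1 D - residue D) / 2).sum) + 3 * m = P.flatten.flatten.length := by
    intro P
    induction P with
    | nil => exact ⟨0, rfl⟩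
    | cons D P ih =>
      obtain ⟨m, hm⟩ := ih
      obtain ⟨m', hm'⟩ := piece D
      refine ⟨m + m', ?_⟩
      simp only [List.map_cons, List.sum_cons, List.flatten_cons, List.flatten_append,
        List.length_append]
      have : residue D = numType 1 D % 2 := rfl
      omega
  obtain ⟨m, hm⟩ := total (pieces T)
  have hcard : (pieces T).flatten.flatten.length = T.card := by
    simp [pieces, blocks, List.flatten_splitBy]
  rw [hcard] at hm
  have ha : a T = ((pieces T).map residue).sum := rfl
  have hb : b T = ((pieces T).map (numType 2)).sum +
    ((pieces T).map fun D => (numType 1 D - residue D) / 2).sum := rfl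
  unfold c
  omega

end BlockDecomposition

/-!
Number the vertices of the path `0, …, n` and let the edge `{j, j + 1}` have weight `v j`, so that
`v` is nondecreasing. The combinatorial invariant `k` of `Δ` is the largest number of elements of
`Δ` with pairwise distances at least `3` (`greedyCount`, `k_eq_greedyCount`). Read from the left, a
greedy choice takes `⌈L / 3⌉` elements from a block of length `L` that it may enter at its first
element, and `⌈(L - 1) / 3⌉` elements if it must skip the first one. It has to skip the first element
of a block of nonzero type exactly when an odd number of blocks of type `1` precede it in its piece,
so a piece with `t` blocks of type `1` gets `⌈t / 2⌉` elements on account of these.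

*Lower bound.* Call a set `V` of variables avoided (`Avoids`) by a monomial ideal `I` if `V` is not
contained in any colon ideal `I : x ^ t` with `x ^ t ∉ I`. In the path ideal, the two vertices of the
last edge are avoided, and so is `{j - 1, j, j + 1}` if `v j = v (j + 1)` (`avoids_last`,
`avoids_of_eq`). A packing in `Δ` thus gives `k + 1` pairwise disjoint avoided
sets, and the sums of the variables over them form a regular sequence. To see this
(`isWeaklyRegular_pathPred`), take the last edge `{m, m + 1}` and use the exact sequence
`0 → S/(I : f) → S/I → S/(I, f) → 0` with `f = x_m ^ v m`. As the weights increase, `I : f` and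
`(I, f)` are again ideals of shorter paths plus powers of other variables, and avoided sets
stay avoided. At the end of the recursion there are primes generated by variables, modulo which
the sums of variables are visibly regular (`isWeaklyRegular_varSum_of_variables`).

*Upper bound.* Following the greedy choice one finds a monomial `x ^ u` for which `I : x ^ u` is
generated by all variables but `k + 1` of them (`exists_isColonWitness_pathPred`). This is an
associated prime `P` with `dim S/P = k + 1`, and regular sequences in a maximal ideal containing `P`
have length at most `dim S/P` (`length_le_ringKrullDim_quotient`).
-/

open MvPolynomial RingTheory.Sequence

/-! ### Regular sequences and associated primes -/

open scoped Pointwise in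
/-- Weak regularity passes from the outer terms of a short exact sequence to the middle one. -/
theorem isWeaklyRegular_of_exact {R : Type*} [CommRing R] (rs : List R) :
    ∀ {A B C : Type _} [AddCommGroup A] [Module R A] [AddCommGroup B] [Module R B]
      [AddCommGroup C] [Module R C] (f : A →ₗ[R] B) (g : B →ₗ[R] C),
      Function.Injective f → Function.Exact f g → Function.Surjective g →
      IsWeaklyRegular A rs → IsWeaklyRegular C rs → IsWeaklyRegular B rs := by
  induction rs with
  | nil => intros; exact IsWeaklyRegular.nil R _
  | cons r rs ih =>
    intro A B C _ _ _ _ _ _ f g hf hfg hg hA hC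
    rw [isWeaklyRegular_cons_iff] at hA hC ⊢
    refine ⟨isSMulRegular_of_range_eq_ker hf (LinearMap.exact_iff.mp hfg).symm hA.1 hC.1, ?_⟩
    refine ih (QuotSMulTop.map r f) (QuotSMulTop.map r g) ?_ (QuotSMulTop.map_exact r hfg hg)
      (QuotSMulTop.map_surjective r hg) hA.2 hC.2
    have h0 : Function.Exact (0 : A →ₗ[R] A) f := by
      rw [LinearMap.exact_iff, LinearMap.ker_eq_bot.mpr hf, LinearMap.range_zero]
    have := QuotSMulTop.map_first_exact_on_four_term_exact_of_isSMulRegular_last h0 hfg hC.1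
    rw [LinearMap.exact_iff] at this
    rw [← LinearMap.ker_eq_bot, this]
    simp

/-- The short exact sequence `0 → R/(I : f) → R/I → R/(I, f) → 0` for weak regularity. -/
theorem isWeaklyRegular_quotient_of_colon_of_sup {R : Type*} [CommRing R] {I J : Ideal R} {f : R}
    (hJ : ∀ p, p ∈ J ↔ f * p ∈ I) {rs : List R} (h1 : IsWeaklyRegular (R ⧸ J) rs)
    (h2 : IsWeaklyRegular (R ⧸ (I ⊔ Ideal.span {f})) rs) : IsWeaklyRegular (R ⧸ I) rs := by
  have hle : J ≤ Submodule.comap (LinearMap.mulLeft R f) I := fun p hp => (hJ p).mp hp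
  refine isWeaklyRegular_of_exact rs (Submodule.mapQ J I (LinearMap.mulLeft R f) hle)
    (Submodule.factor (le_sup_left : I ≤ I ⊔ Ideal.span {f})) ?_ ?_ ?_ h1 h2
  · rw [injective_iff_map_eq_zero]
    intro x hx
    obtain ⟨p, rfl⟩ := Submodule.Quotient.mk_surjective _ x
    rw [Submodule.mapQ_apply, Submodule.Quotient.mk_eq_zero] at hx
    exact (Submodule.Quotient.mk_eq_zero _).mpr ((hJ p).mpr hx)
  · intro x
    obtain ⟨p, rfl⟩ := Submodule.Quotient.mk_surjective _ x
    constructor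
    · intro hx
      change Submodule.Quotient.mk p = 0 at hx
      rw [Submodule.Quotient.mk_eq_zero, Submodule.mem_sup] at hx
      obtain ⟨a, ha, b, hb, rfl⟩ := hx
      obtain ⟨q, rfl⟩ := Ideal.mem_span_singleton'.mp hb
      refine ⟨Submodule.Quotient.mk q, ?_⟩
      rw [Submodule.mapQ_apply, LinearMap.mulLeft_apply, eq_comm, Submodule.Quotient.eq]
      convert ha using 1
      ring
    · rintro ⟨y, hy⟩
      obtain ⟨q, rfl⟩ := Submodule.Quotient.mk_surjective _ y
      rw [← hy]
      change Submodule.Quotient.mk (f * q) = 0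
      rw [Submodule.Quotient.mk_eq_zero]
      exact Ideal.mem_sup_right (Ideal.mul_mem_right _ _ (Ideal.mem_span_singleton_self f))
  · exact Submodule.factor_surjective _

open scoped Pointwise in
/-- A criterion for weak regularity on `R/J` in terms of ideal membership only. -/
theorem isWeaklyRegular_quotient_of_forall {R : Type*} [CommRing R] (rs : List R) :
    ∀ J : Ideal R, (∀ (l₁ : List R) (r : R) (l₂ : List R), rs = l₁ ++ r :: l₂ →
      ∀ x, r * x ∈ J ⊔ Ideal.ofList l₁ → x ∈ J ⊔ Ideal.ofList l₁) →
    IsWeaklyRegular (R ⧸ J) rs := by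
  induction rs with
  | nil => intros; exact IsWeaklyRegular.nil R _
  | cons r rs ih =>
    intro J h
    rw [isWeaklyRegular_cons_iff]
    constructor
    · rw [isSMulRegular_quotient_iff_mem_of_smul_mem]
      intro x hx
      simpa using h [] r rs rfl x (by simpa using hx)
    · have hQ := ih (J ⊔ Ideal.span {r}) (by
        intro l₁ s l₂ hl x hx
        have := h (r :: l₁) s l₂ (by rw [hl]; rfl) x (by
          rw [Ideal.ofList_cons, ← sup_assoc]; exact hx)
        rwa [Ideal.ofList_cons, ← sup_assoc] at this)
      refine (LinearEquiv.isWeaklyRegular_congr ?_ rs).mpr hQ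
      have e : r • (⊤ : Submodule R (R ⧸ J)) =
          Submodule.map J.mkQ (J ⊔ Ideal.span {r}) := by
        ext y
        rw [Submodule.mem_smul_pointwise_iff_exists, Submodule.mem_map]
        constructor
        · rintro ⟨z, -, rfl⟩
          obtain ⟨z, rfl⟩ := Submodule.mkQ_surjective _ z
          exact ⟨r • z, Ideal.mem_sup_right
            (Ideal.mul_mem_right _ _ (Ideal.mem_span_singleton_self r)), map_smul _ _ _⟩
        · rintro ⟨z, hz, rfl⟩
          obtain ⟨a, ha, b, hb, rfl⟩ := Submodule.mem_sup.mp hz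
          obtain ⟨q, rfl⟩ := Ideal.mem_span_singleton'.mp hb
          refine ⟨Submodule.mkQ J q, trivial, ?_⟩
          rw [← map_smul, ← sub_eq_zero, ← map_sub, Submodule.mkQ_apply,
            Submodule.Quotient.mk_eq_zero, smul_eq_mul]
          have := J.neg_mem ha
          convert this using 1
          ring
      exact (Submodule.quotEquivOfEq _ _ e).trans
        (Submodule.quotientQuotientEquivQuotient J (J ⊔ Ideal.span {r}) le_sup_left)

open scoped Pointwise in
/-- If `x` is regular on `M` and `P ∈ Ass M`, there is `Q ∈ Ass (M / x M)` containing `P` and `x`.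
The submodule `N = {m | P m = 0}` is nonzero; by regularity `N ∩ x M = x N`, so by Nakayama's lemma
`N` is not contained in `x M`. An element of `N` outside `x M` has nonzero image in `M / x M`,
killed by both `P` and `x`. -/
theorem exists_isAssociatedPrime_quotSMulTop {R : Type*} [CommRing R] [IsLocalRing R]
    [IsNoetherianRing R] {M : Type*} [AddCommGroup M] [Module R M] [Module.Finite R M]
    {P : Ideal R} (hP : IsAssociatedPrime P M) {x : R} (hx : x ∈ IsLocalRing.maximalIdeal R)
    (hreg : IsSMulRegular M x) :
    ∃ Q, IsAssociatedPrime Q (QuotSMulTop x M) ∧ P ≤ Q ∧ x ∈ Q := by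
  obtain ⟨hPp, y, hy⟩ := (isAssociatedPrime_iff).mp hP
  let N : Submodule R M :=
    { carrier := {m | ∀ p ∈ P, p • m = 0}
      add_mem' := fun {a b} ha hb p hp => by rw [smul_add, ha p hp, hb p hp, add_zero]
      zero_mem' := fun p _ => smul_zero p
      smul_mem' := fun c m hm p hp => by rw [smul_comm, hm p hp, smul_zero] }
  have hyN : y ∈ N := fun p hp => by
    rw [hy, Submodule.mem_colon_singleton] at hp
    exact hp
  have hy0 : y ≠ 0 := by
    rintro rfl
    apply hPp.ne_top
    rw [hy, Ideal.eq_top_iff_one, Submodule.mem_colon_singleton]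
    simp
  have hN : ¬ N ≤ x • (⊤ : Submodule R M) := by
    intro hle
    have : N ≤ IsLocalRing.maximalIdeal R • N := by
      intro m hm
      obtain ⟨m', -, rfl⟩ := (Submodule.mem_smul_pointwise_iff_exists _ _ _).mp (hle hm)
      refine Submodule.smul_mem_smul hx fun p hp => hreg ?_
      have := hm p hp
      simp only [smul_zero]
      rwa [smul_comm]
    have := Submodule.eq_bot_of_le_smul_of_le_jacobson_bot _ N (IsNoetherian.noetherian N) this
      (IsLocalRing.maximalIdeal_le_jacobson ⊥)
    rw [this] at hyN
    exact hy0 ((Submodule.mem_bot R).mp hyN)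
  obtain ⟨m, hmN, hm⟩ := SetLike.not_le_iff_exists.mp hN
  obtain ⟨Q, hQ, hle⟩ := exists_le_isAssociatedPrime_of_isNoetherianRing R
    (Submodule.Quotient.mk m : QuotSMulTop x M)
    (fun h => hm ((Submodule.Quotient.mk_eq_zero _).mp h))
  refine ⟨Q, hQ, fun p hp => hle ?_, hle ?_⟩
  · rw [Submodule.mem_colon_singleton, ← Submodule.Quotient.mk_smul, hmN p hp]
    simp
  · rw [Submodule.mem_colon_singleton, ← Submodule.Quotient.mk_smul, Submodule.mem_bot,
      Submodule.Quotient.mk_eq_zero]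
    exact Submodule.smul_mem_pointwise_smul _ _ _ trivial

theorem length_le_ringKrullDim_of_isLocalRing {R : Type*} [CommRing R] [IsLocalRing R]
    [IsNoetherianRing R] (rs : List R) : ∀ {M : Type _} [AddCommGroup M] [Module R M]
    [Module.Finite R M] {P : Ideal R}, IsAssociatedPrime P M →
    (∀ r ∈ rs, r ∈ IsLocalRing.maximalIdeal R) → IsWeaklyRegular M rs →
    (rs.length : WithBot ℕ∞) ≤ ringKrullDim (R ⧸ P) := by
  induction rs with
  | nil =>
    intro M _ _ _ P hP _ _
    have := hP.isPrime
    simpa using ringKrullDim_nonneg_of_nontrivial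
  | cons x rs ih =>
    intro M _ _ _ P hP hmem hreg
    rw [isWeaklyRegular_cons_iff] at hreg
    have hPp := hP.isPrime
    obtain ⟨Q, hQ, hPQ, hxQ⟩ := exists_isAssociatedPrime_quotSMulTop hP (hmem x (by simp)) hreg.1
    have h1 := ih hQ (fun r hr => hmem r (by simp [hr])) hreg.2
    have hxP : x ∉ P := by
      obtain ⟨-, y, hy⟩ := (isAssociatedPrime_iff).mp hP
      intro hx
      rw [hy, Submodule.mem_colon_singleton, Submodule.mem_bot] at hx
      have hy0 : y = 0 := hreg.1 (by simpa using hx)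
      apply hPp.ne_top
      rw [hy, hy0, Ideal.eq_top_iff_one, Submodule.mem_colon_singleton]
      simp
    have h2 := ringKrullDim_quotient_succ_le_of_nonZeroDivisor (R := R ⧸ P)
      (r := Ideal.Quotient.mk P x) (mem_nonZeroDivisors_of_ne_zero
        (fun h => hxP (Ideal.Quotient.eq_zero_iff_mem.mp h)))
    have h3 : ringKrullDim (R ⧸ Q) ≤
        ringKrullDim ((R ⧸ P) ⧸ Ideal.span {Ideal.Quotient.mk P x}) := by
      refine ringKrullDim_le_of_surjective (Ideal.Quotient.lift _ (Ideal.Quotient.factor hPQ) ?_) ?_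
      · intro a ha
        obtain ⟨b, rfl⟩ := Ideal.mem_span_singleton'.mp ha
        rw [map_mul, Ideal.Quotient.factor_mk, Ideal.Quotient.eq_zero_iff_mem.mpr hxQ, mul_zero]
      · exact Ideal.Quotient.lift_surjective_of_surjective _ _
          (Ideal.Quotient.factor_surjective hPQ)
    rw [List.length_cons]
    push_cast
    exact le_trans (add_le_add_left (h1.trans h3) 1) h2

/-- The length of a regular sequence in a maximal ideal is at most the dimension of `R/P` for each
associated prime `P` contained in that maximal ideal. -/
theorem length_le_ringKrullDim_quotient {R : Type*} [CommRing R] [IsNoetherianRing R]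
    {M : Type*} [AddCommGroup M] [Module R M] [Module.Finite R M] {P : Ideal R}
    (hP : IsAssociatedPrime P M) {m : Ideal R} [m.IsPrime] (hPm : P ≤ m) {rs : List R}
    (hmem : ∀ r ∈ rs, r ∈ m) (hreg : IsWeaklyRegular M rs) :
    (rs.length : WithBot ℕ∞) ≤ ringKrullDim (R ⧸ P) := by
  have hPp := hP.isPrime
  let A := Localization.AtPrime m
  let Pm : Ideal A := P.map (algebraMap R A)
  have hdisj : Disjoint (m.primeCompl : Set R) (P : Set R) :=
    Set.disjoint_left.mpr fun a ha ha' => ha (hPm ha')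
  have hcomap : Pm.comap (algebraMap R A) = P :=
    IsLocalization.under_map_of_isPrime_disjoint m.primeCompl A ‹_› hdisj
  have hass : IsAssociatedPrime Pm (LocalizedModule m.primeCompl M) :=
    Module.associatedPrimes.mem_associatedPrimes_of_comap_mem_associatedPrimes_of_isLocalizedModule
      m.primeCompl (LocalizedModule.mkLinearMap m.primeCompl M) Pm (by rw [hcomap]; exact hP)
  have h1 := length_le_ringKrullDim_of_isLocalRing (rs.map (algebraMap R A)) hass (by
      intro r hr
      obtain ⟨s, hs, rfl⟩ := List.mem_map.mp hr
      exact (IsLocalization.AtPrime.to_map_mem_maximal_iff A m s).mpr (hmem s hs))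
    (hreg.of_isLocalizedModule A m.primeCompl (LocalizedModule.mkLinearMap m.primeCompl M))
  rw [List.length_map] at h1
  refine h1.trans ?_
  rw [ringKrullDim_quotient, ringKrullDim_quotient]
  refine Order.krullDim_le_of_strictMono (fun q => ⟨PrimeSpectrum.comap (algebraMap R A) q.1, ?_⟩) ?_
  · intro a ha
    exact q.2 (Ideal.mem_map_of_mem _ ha)
  · refine Monotone.strictMono_of_injective (fun p q h => Ideal.comap_mono h) fun p q h => ?_
    exact Subtype.ext (PrimeSpectrum.localization_comap_injective A m.primeCompl
      (Subtype.ext_iff.mp h))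

/-! ### Linear forms modulo variables -/

/-- The sum of the variables with index in `V`. -/
noncomputable def varSum {σ : Type*} (K : Type*) [Field K] (V : Finset σ) : MvPolynomial σ K :=
  ∑ v ∈ V, X v

/-- Modulo the variables in `C` and the sums of variables over disjoint sets `V` in `l`, one
variable of each `V` can be eliminated: the quotient embeds into a polynomial ring. -/
theorem exists_elimination {σ K : Type*} [Field K] (C : Set σ) (l : List (Finset σ))
    (hl : l.Pairwise Disjoint) (hC : ∀ V ∈ l, ∃ v ∈ V, v ∉ C) :
    ∃ Φ : MvPolynomial σ K →ₐ[K] MvPolynomial σ K,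
      RingHom.ker Φ = Ideal.span (X '' C) ⊔ Ideal.ofList (l.map (varSum K)) ∧
      (∀ i ∈ C, Φ (X i) = 0) ∧ ∀ i, i ∉ C → (∀ V ∈ l, i ∉ V) → Φ (X i) = X i := by
  classical
  choose v hvV hvC using hC
  have huniq : ∀ V ∈ l, ∀ V' ∈ l, ∀ i, i ∈ V → i ∈ V' → V = V' := by
    intro V hV V' hV' i hi hi'
    by_contra hne
    exact Finset.disjoint_left.mp (hl.forall hV hV' hne) hi hi'
  let F : σ → MvPolynomial σ K := fun i =>
    if i ∈ C then 0 else
      if h : ∃ V, ∃ hV : V ∈ l, v V hV = i then X i - ∑ j ∈ h.choose with j ∉ C, X j else X i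
  have hF0 : ∀ i ∈ C, F i = 0 := fun i hi => if_pos hi
  have hF1 : ∀ V (hV : V ∈ l), F (v V hV) = X (v V hV) - ∑ j ∈ V with j ∉ C, X j := by
    intro V hV
    have h : ∃ V', ∃ hV' : V' ∈ l, v V' hV' = v V hV := ⟨V, hV, rfl⟩
    have key : ∀ V' (hV' : V' ∈ l), v V' hV' = v V hV → V' = V := fun V' hV' he =>
      huniq V' hV' V hV (v V hV) (he ▸ hvV V' hV') (hvV V hV)
    have : h.choose = V := key _ h.choose_spec.choose h.choose_spec.choose_spec
    simp only [F, if_neg (hvC V hV), dif_pos h, this]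
  have hF2 : ∀ i, i ∉ C → (∀ V, ∀ hV : V ∈ l, v V hV ≠ i) → F i = X i := by
    intro i hi h
    have h' : ¬ ∃ V, ∃ hV : V ∈ l, v V hV = i := by push Not; exact h
    simp only [F, if_neg hi, dif_neg h']
  refine ⟨aeval F, le_antisymm ?_ ?_, fun i hi => by rw [aeval_X, hF0 i hi], fun i hi h => ?_⟩
  · set J := Ideal.span (X '' C) ⊔ Ideal.ofList (l.map (varSum K)) with hJ
    have hX : ∀ i ∈ C, (X i : MvPolynomial σ K) ∈ J := fun i hi =>
      Ideal.mem_sup_left (Ideal.subset_span ⟨i, hi, rfl⟩)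
    have hcomp : (Ideal.Quotient.mkₐ K J).comp (aeval F) = Ideal.Quotient.mkₐ K J := by
      refine algHom_ext fun i => ?_
      rw [AlgHom.comp_apply, aeval_X, ← sub_eq_zero, ← map_sub, Ideal.Quotient.mkₐ_eq_mk,
        Ideal.Quotient.eq_zero_iff_mem]
      by_cases hi : i ∈ C
      · rw [hF0 i hi, zero_sub]
        exact J.neg_mem (hX i hi)
      by_cases h : ∃ V, ∃ hV : V ∈ l, v V hV = i
      · obtain ⟨V, hV, rfl⟩ := h
        rw [hF1 V hV, sub_sub_cancel_left]
        refine J.neg_mem ?_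
        have h1 : varSum K V ∈ J :=
          Ideal.mem_sup_right (Ideal.subset_span (List.mem_map_of_mem hV))
        rw [varSum, ← Finset.sum_filter_add_sum_filter_not V (fun j => j ∉ C)] at h1
        refine (J.add_mem_iff_left (J.sum_mem fun j hj => hX j ?_)).mp h1
        simpa using (Finset.mem_filter.mp hj).2
      · push Not at h
        rw [hF2 i hi h, sub_self]
        exact J.zero_mem
    intro p hp
    have := DFunLike.congr_fun hcomp p
    rw [AlgHom.comp_apply, (RingHom.mem_ker).mp hp, map_zero] at this
    exact Ideal.Quotient.eq_zero_iff_mem.mp this.symm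
  · refine sup_le (Ideal.span_le.mpr ?_) (Ideal.span_le.mpr ?_)
    · rintro _ ⟨i, hi, rfl⟩
      simp [RingHom.mem_ker, hF0 i hi]
    · intro p hp
      obtain ⟨V, hV, rfl⟩ := List.mem_map.mp (show p ∈ l.map (varSum K) from hp)
      rw [SetLike.mem_coe, RingHom.mem_ker, varSum, map_sum]
      simp only [aeval_X]
      rw [← Finset.sum_filter_add_sum_filter_not V (fun j => j ∉ C)]
      have h2 : ∑ j ∈ V with ¬ j ∉ C, F j = 0 :=
        Finset.sum_eq_zero fun j hj => hF0 j (by simpa using (Finset.mem_filter.mp hj).2)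
      have hmem : v V hV ∈ V.filter fun j => j ∉ C :=
        Finset.mem_filter.mpr ⟨hvV V hV, hvC V hV⟩
      have h3 : ∑ j ∈ (V.filter fun j => j ∉ C).erase (v V hV), F j =
          ∑ j ∈ (V.filter fun j => j ∉ C).erase (v V hV), X j := by
        refine Finset.sum_congr rfl fun j hj => ?_
        rw [Finset.mem_erase, Finset.mem_filter] at hj
        refine hF2 j hj.2.2 fun V' hV' h => hj.1 ?_
        obtain rfl := huniq V hV V' hV' j hj.2.1 (h ▸ hvV V' hV')
        exact h.symm
      rw [h2, add_zero, ← Finset.add_sum_erase _ _ hmem, h3, hF1 V hV, sub_add_eq_add_sub,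
        Finset.add_sum_erase _ _ hmem, sub_self]
  · rw [aeval_X]
    exact hF2 i hi fun V hV hvi => h V hV (hvi ▸ hvV V hV)

/-- Sums of variables over pairwise disjoint sets, none of them contained in `C`, form a weakly
regular sequence modulo the variables in `C`. -/
theorem isWeaklyRegular_varSum_of_variables {σ K : Type*} [Field K] (C : Set σ)
    (l : List (Finset σ)) (hl : l.Pairwise Disjoint) (hC : ∀ V ∈ l, ∃ v ∈ V, v ∉ C) :
    IsWeaklyRegular (MvPolynomial σ K ⧸ Ideal.span (X '' C : Set (MvPolynomial σ K)))
      (l.map (varSum K)) := by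
  classical
  refine isWeaklyRegular_quotient_of_forall _ _ fun l₁ r l₂ hsplit x hx => ?_
  obtain ⟨a, b', rfl, rfl, hb⟩ := List.map_eq_append_iff.mp hsplit
  obtain ⟨V, b, rfl, rfl, rfl⟩ := List.map_eq_cons_iff.mp hb
  rw [List.pairwise_append] at hl
  obtain ⟨Φ, hker, h0, hfix⟩ := exists_elimination (K := K) C a hl.1
    fun V' hV' => hC V' (by simp [hV'])
  rw [← hker, RingHom.mem_ker] at hx ⊢
  rw [map_mul] at hx
  refine (mul_eq_zero.mp hx).resolve_left fun hV => ?_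
  obtain ⟨v, hv, hvC⟩ := hC V (by simp)
  have h1 : ∀ j ∈ V, Φ (X j) = if j ∈ C then 0 else X j := by
    intro j hj
    split_ifs with h
    · exact h0 j h
    · exact hfix j h fun V' hV' hj' => Finset.disjoint_left.mp (hl.2.2 V' hV' V (by simp)) hj' hj
  rw [varSum, map_sum, Finset.sum_congr rfl h1] at hV
  have h2 := congrArg (MvPolynomial.eval (Pi.single v (1 : K))) hV
  rw [map_sum, Finset.sum_eq_single v] at h2
  · simp [hvC] at h2
  · intro j _ hjv
    split_ifs <;> simp [hjv]
  · exact fun h => absurd hv h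

theorem isPrime_span_X_image {σ K : Type*} [Field K] (C : Set σ) :
    (Ideal.span (X '' C : Set (MvPolynomial σ K))).IsPrime := by
  obtain ⟨Φ, hker, -⟩ := exists_elimination (K := K) C [] List.Pairwise.nil (by simp)
  have : Ideal.span (X '' C) = RingHom.ker Φ := by simp [hker]
  rw [this]
  exact RingHom.ker_isPrime Φ.toRingHom

theorem ringKrullDim_quotient_span_X_image_le {K : Type*} [Field K] {N : ℕ} (C : Finset (Fin N)) :
    ringKrullDim (MvPolynomial (Fin N) K ⧸
      Ideal.span (X '' (C : Set (Fin N)) : Set (MvPolynomial (Fin N) K))) ≤ (N - C.card : ℕ) := by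
  classical
  have h : ringKrullDim (MvPolynomial {i // i ∉ C} K) = (N - C.card : ℕ) := by
    rw [MvPolynomial.ringKrullDim_of_isNoetherianRing, ringKrullDim_eq_zero_of_field, zero_add,
      Nat.card_eq_fintype_card, Fintype.card_subtype_compl, Fintype.card_fin, Fintype.card_coe]
  rw [← h]
  refine ringKrullDim_le_of_surjective
    ((Ideal.Quotient.mkₐ K _).comp (rename (Subtype.val : {i // i ∉ C} → Fin N))).toRingHom ?_
  let Ψ : MvPolynomial (Fin N) K →ₐ[K] MvPolynomial {i // i ∉ C} K :=
    aeval fun i => if h : i ∉ C then X ⟨i, h⟩ else 0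
  intro y
  obtain ⟨p, rfl⟩ := Ideal.Quotient.mk_surjective y
  refine ⟨Ψ p, ?_⟩
  set J := Ideal.span (X '' (C : Set (Fin N)) : Set (MvPolynomial (Fin N) K))
  have : ((Ideal.Quotient.mkₐ K J).comp (rename Subtype.val)).comp Ψ = Ideal.Quotient.mkₐ K J := by
    refine algHom_ext fun i => ?_
    simp only [AlgHom.comp_apply, Ψ, aeval_X]
    split_ifs with h
    · rw [map_zero, map_zero, eq_comm, Ideal.Quotient.mkₐ_eq_mk, Ideal.Quotient.eq_zero_iff_mem]
      exact Ideal.subset_span ⟨i, h, rfl⟩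
    · simp
  exact DFunLike.congr_fun this p

/-! ### Monomial ideals -/

/-- An exponent vector in finitely many variables, extended by zero to all of `ℕ`. -/
def extendExp {N : ℕ} (s : Fin N →₀ ℕ) (i : ℕ) : ℕ := if h : i < N then s ⟨i, h⟩ else 0

theorem extendExp_apply {N : ℕ} (s : Fin N →₀ ℕ) (i : Fin N) : extendExp s i = s i := by
  simp [extendExp]

theorem extendExp_add {N : ℕ} (s t : Fin N →₀ ℕ) :
    extendExp (s + t) = extendExp s + extendExp t := by
  ext i
  by_cases h : i < N <;> simp [extendExp, h]

theorem extendExp_single {N : ℕ} (i : Fin N) (k : ℕ) :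
    extendExp (Finsupp.single i k) = Pi.single (i : ℕ) k := by
  ext j
  by_cases h : j < N
  · simp [extendExp, h, Finsupp.single_apply, Pi.single_apply, Fin.ext_iff, eq_comm]
  · have : j ≠ i := fun hj => h (hj ▸ i.2)
    simp [extendExp, h, this]

theorem extendExp_mono {N : ℕ} {s t : Fin N →₀ ℕ} (h : s ≤ t) : extendExp s ≤ extendExp t := by
  intro i
  by_cases hi : i < N
  · simpa [extendExp, hi] using h ⟨i, hi⟩
  · simp [extendExp, hi]

/-- The monomial ideal of `K[x_0, …, x_{N-1}]` whose monomials are those with exponent vector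
satisfying the monotone predicate `E`. Exponent vectors are functions on `ℕ`, so that a predicate
need not refer to `N`. -/
noncomputable def monIdeal (K : Type*) [Field K] (N : ℕ) (E : (ℕ → ℕ) → Prop) (hE : Monotone E) :
    Ideal (MvPolynomial (Fin N) K) :=
  restrictSupportIdeal K {s : Fin N →₀ ℕ | E (extendExp s)} fun _ _ h hs => hE (extendExp_mono h) hs

section monIdeal

variable {K : Type*} [Field K] {N : ℕ} {E : (ℕ → ℕ) → Prop} (hE : Monotone E)

theorem mem_monIdeal {p : MvPolynomial (Fin N) K} :
    p ∈ monIdeal K N E hE ↔ ∀ s ∈ p.support, E (extendExp s) := Iff.rfl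

theorem monomial_mem_monIdeal (s : Fin N →₀ ℕ) :
    monomial s (1 : K) ∈ monIdeal K N E hE ↔ E (extendExp s) := by
  classical
  rw [mem_monIdeal, support_monomial]
  simp

theorem monIdeal_congr {E' : (ℕ → ℕ) → Prop} (hE' : Monotone E') (h : ∀ t, E t ↔ E' t) :
    monIdeal K N E hE = monIdeal K N E' hE' := by
  obtain rfl : E = E' := funext fun t => propext (h t)
  rfl

include hE in
theorem monotone_pred_add (u : ℕ → ℕ) : Monotone fun t => E (t + u) :=
  fun _ _ h => hE (add_le_add_left h u)

include hE in
theorem monotone_pred_or_le (i k : ℕ) : Monotone fun t : ℕ → ℕ => E t ∨ k ≤ t i :=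
  fun _ _ h => Or.imp (hE h) fun hk => hk.trans (h i)

theorem monomial_mul_mem_monIdeal (u : Fin N →₀ ℕ) (p : MvPolynomial (Fin N) K) :
    monomial u 1 * p ∈ monIdeal K N E hE ↔
      p ∈ monIdeal K N (fun t => E (t + extendExp u)) (monotone_pred_add hE _) := by
  classical
  simp only [mem_monIdeal, mem_support_iff]
  constructor
  · intro h s hs
    rw [← extendExp_add, add_comm]
    apply h
    rwa [coeff_monomial_mul, one_mul]
  · intro h s hs
    rw [coeff_monomial_mul'] at hs
    split_ifs at hs with hus
    · have := h (s - u) (by simpa using hs)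
      rwa [← extendExp_add, tsub_add_cancel_of_le hus] at this
    · exact absurd rfl hs

theorem monIdeal_sup_span_monomial (i : Fin N) (k : ℕ) :
    monIdeal K N E hE ⊔ Ideal.span {monomial (Finsupp.single i k) 1} =
      monIdeal K N (fun t => E t ∨ k ≤ t i) (monotone_pred_or_le hE i k) := by
  classical
  apply le_antisymm
  · refine sup_le (fun p hp s hs => Or.inl (hp hs)) ((Ideal.span_singleton_le_iff_mem _).mpr ?_)
    rw [monomial_mem_monIdeal]
    right
    simp [extendExp_apply]
  · intro p hp
    rw [← support_sum_monomial_coeff p]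
    refine Ideal.sum_mem _ fun s hs => ?_
    have hC : monomial s (coeff s p) = C (coeff s p) * monomial s 1 := by simp [C_mul_monomial]
    rw [hC]
    refine Ideal.mul_mem_left _ _ ?_
    rcases hp hs with h | h
    · exact Ideal.mem_sup_left ((monomial_mem_monIdeal hE s).mpr h)
    · refine Ideal.mem_sup_right (Ideal.mem_span_singleton.mpr ?_)
      refine monomial_dvd_monomial.mpr ⟨Or.inr ?_, dvd_rfl⟩
      rw [extendExp_apply] at h
      simpa using h

/-- Splitting a monomial ideal along a pure power `x_i ^ k`: weak regularity for `I : x_i ^ k` and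
`(I, x_i ^ k)` gives weak regularity for `I`. -/
theorem isWeaklyRegular_monIdeal_of_split {rs : List (MvPolynomial (Fin N) K)} (i : Fin N) (k : ℕ)
    {E₁ E₂ : (ℕ → ℕ) → Prop} (hE₁ : Monotone E₁) (hE₂ : Monotone E₂)
    (h₁ : ∀ t, E (t + Pi.single (i : ℕ) k) ↔ E₁ t) (h₂ : ∀ t, E t ∨ k ≤ t i ↔ E₂ t)
    (hw₁ : IsWeaklyRegular (MvPolynomial (Fin N) K ⧸ monIdeal K N E₁ hE₁) rs)
    (hw₂ : IsWeaklyRegular (MvPolynomial (Fin N) K ⧸ monIdeal K N E₂ hE₂) rs) :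
    IsWeaklyRegular (MvPolynomial (Fin N) K ⧸ monIdeal K N E hE) rs := by
  obtain rfl : _ = E₁ := funext fun t => propext (h₁ t)
  obtain rfl : _ = E₂ := funext fun t => propext (h₂ t)
  refine isWeaklyRegular_quotient_of_colon_of_sup (f := monomial (Finsupp.single i k) 1)
    (fun p => ?_) hw₁ (by rwa [monIdeal_sup_span_monomial])
  rw [monomial_mul_mem_monIdeal]
  simp only [extendExp_single]

end monIdeal

theorem monIdeal_eq_span_X {K : Type*} [Field K] {N : ℕ} {E : (ℕ → ℕ) → Prop} (hE : Monotone E)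
    (C : Set (Fin N)) (h : ∀ s : Fin N →₀ ℕ, E (extendExp s) ↔ ∃ i ∈ C, 0 < s i) :
    monIdeal K N E hE = Ideal.span (X '' C) := by
  ext p
  rw [mem_monIdeal, mem_ideal_span_X_image]
  refine forall₂_congr fun s _ => (h s).trans ?_
  simp [Nat.pos_iff_ne_zero]

/-! ### Regular sequences modulo ideals of increasing paths -/

/-- The exponent vectors of the monomials in the ideal of the path with vertices `0, …, m` and edges
`{j, j + 1}` of weight `v j` for `j < m`, together with the powers `x_i ^ c i` of the variables with
`m ≤ i`; here `c i = 0` means that no power of `x_i` is added. -/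
def PathPred (v : ℕ → ℕ) (m : ℕ) (c t : ℕ → ℕ) : Prop :=
  (∃ j < m, v j ≤ t j ∧ v j ≤ t (j + 1)) ∨ ∃ i, m ≤ i ∧ 0 < c i ∧ c i ≤ t i

theorem monotone_pathPred (v : ℕ → ℕ) (m : ℕ) (c : ℕ → ℕ) : Monotone (PathPred v m c) := by
  rintro s t h (⟨j, hj, h1, h2⟩ | ⟨i, hi, h0, h1⟩)
  · exact Or.inl ⟨j, hj, h1.trans (h j), h2.trans (h (j + 1))⟩
  · exact Or.inr ⟨i, hi, h0, h1.trans (h i)⟩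

/-- No monomial `x ^ t` outside the monomial ideal given by `E` is multiplied into that ideal by all
the variables in `V`. Equivalently, `V` is not contained in an associated prime of the ideal. -/
def Avoids {N : ℕ} (E : (ℕ → ℕ) → Prop) (V : Finset (Fin N)) : Prop :=
  ∀ t, ¬ E t → ∃ x ∈ V, ¬ E (t + Pi.single (x : ℕ) 1)

theorem Avoids.add {N : ℕ} {E : (ℕ → ℕ) → Prop} {V : Finset (Fin N)} (h : Avoids E V)
    (u : ℕ → ℕ) : Avoids (fun t => E (t + u)) V := by
  intro t ht
  obtain ⟨x, hx, hE⟩ := h _ ht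
  refine ⟨x, hx, ?_⟩
  dsimp only
  rwa [add_right_comm]

theorem Avoids.congr {N : ℕ} {E E' : (ℕ → ℕ) → Prop} {V : Finset (Fin N)} (h : Avoids E V)
    (hE : ∀ t, E t ↔ E' t) : Avoids E' V :=
  (funext fun t => propext (hE t) : E = E') ▸ h

theorem Avoids.exists_eq_zero {N : ℕ} {v c : ℕ → ℕ} {V : Finset (Fin N)}
    (h : Avoids (PathPred v 0 c) V) : ∃ x ∈ V, c x = 0 := by
  obtain ⟨x, hx, hE⟩ := h (fun i => c i - 1) (by
    rintro (⟨j, hj, -⟩ | ⟨i, -, h0, h1⟩)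
    · omega
    · dsimp only at h1; omega)
  refine ⟨x, hx, ?_⟩
  by_contra hc
  exact hE (Or.inr ⟨x, Nat.zero_le _, Nat.pos_of_ne_zero hc, by
    rw [Pi.add_apply, Pi.single_eq_same]; omega⟩)

/-- Modulo pure powers of variables, sums over disjoint sets are weakly regular as soon as each set
contains a free variable. Splitting along `x_i` lowers the exponents until all of them are `1`. -/
theorem isWeaklyRegular_purePowers {K : Type*} [Field K] {N : ℕ} (v : ℕ → ℕ)
    {l : List (Finset (Fin N))} (hl : l.Pairwise Disjoint) (d : ℕ) : ∀ c : ℕ → ℕ,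
    ∑ i : Fin N, (c i - 1) = d → (∀ V ∈ l, ∃ x ∈ V, c (x : ℕ) = 0) →
    IsWeaklyRegular (MvPolynomial (Fin N) K ⧸
      monIdeal K N (PathPred v 0 c) (monotone_pathPred v 0 c)) (l.map (varSum K)) := by
  induction d using Nat.strong_induction_on with
  | _ d ih =>
  intro c hd hV
  by_cases hc : ∃ i : Fin N, 2 ≤ c i
  · obtain ⟨i, hi⟩ := hc
    have hlt : ∀ k < c i, 0 < k →
        IsWeaklyRegular (MvPolynomial (Fin N) K ⧸ monIdeal K N
          (PathPred v 0 (Function.update c i k)) (monotone_pathPred v 0 _)) (l.map (varSum K)) := by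
      intro k hk hk0
      refine ih (∑ j : Fin N, (Function.update c i k j - 1)) ?_ _ rfl fun V hVl => ?_
      · rw [← hd]
        refine Finset.sum_lt_sum (fun j _ => ?_) ⟨i, Finset.mem_univ i, ?_⟩
        · by_cases hj : (j : ℕ) = i
          · rw [hj, Function.update_self]; omega
          · rw [Function.update_of_ne hj]
        · rw [Function.update_self]; omega
      · obtain ⟨x, hx, hx0⟩ := hV V hVl
        refine ⟨x, hx, ?_⟩
        rwa [Function.update_of_ne]
        intro hxi
        rw [hxi] at hx0
        omega
    refine isWeaklyRegular_monIdeal_of_split _ i 1 (monotone_pathPred v 0 _)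
      (monotone_pathPred v 0 _) (fun t => ?_) (fun t => ?_) (hlt (c i - 1) (by omega) (by omega))
      (hlt 1 (by omega) (by omega))
    · simp only [PathPred, Nat.not_lt_zero, false_and, exists_false, false_or]
      refine exists_congr fun j => ?_
      by_cases hj : j = i
      · subst hj
        simp only [Function.update_self, Pi.add_apply, Pi.single_eq_same]
        omega
      · simp [Function.update_of_ne hj, Pi.single_eq_of_ne hj]
    · simp only [PathPred, Nat.not_lt_zero, false_and, exists_false, false_or]
      constructor
      · rintro (⟨j, h⟩ | h)
        · refine ⟨j, ?_⟩
          by_cases hj : j = i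
          · subst hj
            rw [Function.update_self]
            omega
          · rwa [Function.update_of_ne hj]
        · exact ⟨i, Nat.zero_le _, by simp, by simpa using h⟩
      · rintro ⟨j, h⟩
        by_cases hj : j = i
        · subst hj
          rw [Function.update_self] at h
          exact Or.inr h.2.2
        · rw [Function.update_of_ne hj] at h
          exact Or.inl ⟨j, h⟩
  · push Not at hc
    rw [monIdeal_eq_span_X _ {i : Fin N | 0 < c i}]
    · refine isWeaklyRegular_varSum_of_variables _ l hl fun V hVl => ?_
      obtain ⟨x, hx, hx0⟩ := hV V hVl
      exact ⟨x, hx, by simp [hx0]⟩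
    · intro s
      constructor
      · rintro (⟨j, hj, -⟩ | ⟨i, -, h0, h1⟩)
        · omega
        · have hi : i < N := by
            by_contra hi
            simp only [extendExp, hi, dite_false] at h1
            omega
          refine ⟨⟨i, hi⟩, h0, ?_⟩
          rw [← extendExp_apply]
          exact lt_of_lt_of_le h0 h1
      · rintro ⟨i, h0, h1⟩
        have := hc i
        refine Or.inr ⟨i, Nat.zero_le _, h0, ?_⟩
        rw [extendExp_apply]
        omega

/-- The edge `{m, m + 1}` is redundant in the presence of a power `x_{m + 1} ^ c` with `c ≤ v m`. -/
theorem pathPred_succ_of_le {v c : ℕ → ℕ} {m : ℕ} (h0 : 0 < c (m + 1)) (hc : c (m + 1) ≤ v m)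
    (t : ℕ → ℕ) : PathPred v (m + 1) c t ↔ PathPred v m (Function.update c m 0) t := by
  constructor
  · rintro (⟨j, hj, h1, h2⟩ | ⟨i, hi, h1, h2⟩)
    · rcases Nat.lt_succ_iff_lt_or_eq.mp hj with hj | rfl
      · exact Or.inl ⟨j, hj, h1, h2⟩
      · exact Or.inr ⟨j + 1, by omega, by simpa using h0, by simpa using hc.trans h2⟩
    · refine Or.inr ⟨i, by omega, ?_⟩
      rw [Function.update_of_ne (by omega)]
      exact ⟨h1, h2⟩
  · rintro (⟨j, hj, h⟩ | ⟨i, hi, h1, h2⟩)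
    · exact Or.inl ⟨j, by omega, h⟩
    · by_cases him : i = m
      · subst him
        simp at h1
      · rw [Function.update_of_ne him] at h1 h2
        exact Or.inr ⟨i, by omega, h1, h2⟩

/-- The colon ideal by `x_m ^ v m`. The edge `{m, m + 1}` becomes a power of `x_{m + 1}`, and, as
`v (m - 1) ≤ v m`, the edge `{m - 1, m}` becomes a power of `x_{m - 1}`. -/
theorem pathPred_add_single {v c : ℕ → ℕ} {m : ℕ} (hm : v m ≤ v (m + 1)) (h0 : 0 < v m)
    (h0' : 0 < v (m + 1)) (hc : c (m + 2) = 0 ∨ v (m + 1) < c (m + 2)) (t : ℕ → ℕ) :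
    PathPred v (m + 2) c (t + Pi.single (m + 1) (v (m + 1))) ↔
      PathPred v m (Function.update (Function.update (Function.update c m (v m)) (m + 1) 0)
        (m + 2) (v (m + 1))) t := by
  have e : ∀ j, j ≠ m + 1 → (t + Pi.single (m + 1) (v (m + 1)) : ℕ → ℕ) j = t j := by
    intro j hj
    simp [hj]
  have e' : (t + Pi.single (m + 1) (v (m + 1)) : ℕ → ℕ) (m + 1) = t (m + 1) + v (m + 1) := by simp
  constructor
  · rintro (⟨j, hj, h1, h2⟩ | ⟨i, hi, h1, h2⟩)
    · rcases (by omega : j < m ∨ j = m ∨ j = m + 1) with hj | rfl | rfl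
      · rw [e _ (by omega)] at h1 h2
        exact Or.inl ⟨j, hj, h1, h2⟩
      · rw [e _ (by omega)] at h1
        exact Or.inr ⟨j, le_rfl, by simpa [Function.update_apply] using h0,
          by simpa [Function.update_apply] using h1⟩
      · rw [e _ (by omega)] at h2
        exact Or.inr ⟨m + 2, by omega, by simpa using h0', by simpa using h2⟩
    · rw [e _ (by omega)] at h2
      by_cases him : i = m + 2
      · subst him
        exact Or.inr ⟨m + 2, by omega, by simpa using h0', by simpa using by omega⟩
      · refine Or.inr ⟨i, by omega, ?_⟩
        rw [Function.update_of_ne him, Function.update_of_ne (by omega),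
          Function.update_of_ne (by omega)]
        exact ⟨h1, h2⟩
  · rintro (⟨j, hj, h1, h2⟩ | ⟨i, hi, h1, h2⟩)
    · refine Or.inl ⟨j, by omega, ?_⟩
      rw [e _ (by omega), e _ (by omega)]
      exact ⟨h1, h2⟩
    · rcases (by omega : i = m ∨ i = m + 1 ∨ i = m + 2 ∨ m + 2 < i) with rfl | rfl | rfl | hi
      · rw [Function.update_of_ne (by omega), Function.update_of_ne (by omega),
          Function.update_self] at h2
        refine Or.inl ⟨i, by omega, ?_⟩
        rw [e _ (by omega), e']
        exact ⟨h2, by omega⟩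
      · simp at h1
      · rw [Function.update_self] at h2
        refine Or.inl ⟨m + 1, by omega, ?_⟩
        rw [e', e _ (by omega)]
        exact ⟨by omega, h2⟩
      · rw [Function.update_of_ne (by omega), Function.update_of_ne (by omega),
          Function.update_of_ne (by omega)] at h1 h2
        refine Or.inr ⟨i, by omega, h1, ?_⟩
        rwa [e _ (by omega)]

theorem pathPred_one_add_single {v c : ℕ → ℕ} (h0 : 0 < v 0)
    (hc : c 1 = 0 ∨ v 0 < c 1) (t : ℕ → ℕ) :
    PathPred v 1 c (t + Pi.single 0 (v 0)) ↔
      PathPred v 0 (Function.update (Function.update c 0 0) 1 (v 0)) t := by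
  have e : ∀ j, j ≠ 0 → (t + Pi.single 0 (v 0) : ℕ → ℕ) j = t j := by
    intro j hj
    simp [hj]
  have e' : (t + Pi.single 0 (v 0) : ℕ → ℕ) 0 = t 0 + v 0 := by simp
  constructor
  · rintro (⟨j, hj, h1, h2⟩ | ⟨i, hi, h1, h2⟩)
    · obtain rfl : j = 0 := by omega
      rw [e _ (by omega)] at h2
      exact Or.inr ⟨1, by omega, by simpa using h0, by simpa using h2⟩
    · rw [e _ (by omega)] at h2
      by_cases him : i = 1
      · subst him
        exact Or.inr ⟨1, by omega, by simpa using h0, by simpa using by omega⟩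
      · refine Or.inr ⟨i, by omega, ?_⟩
        rw [Function.update_of_ne him, Function.update_of_ne (by omega)]
        exact ⟨h1, h2⟩
  · rintro (⟨j, hj, -⟩ | ⟨i, hi, h1, h2⟩)
    · omega
    · rcases (by omega : i = 0 ∨ i = 1 ∨ 1 < i) with rfl | rfl | hi
      · simp at h1
      · rw [Function.update_self] at h2
        refine Or.inl ⟨0, by omega, ?_⟩
        rw [e', e _ (by omega)]
        exact ⟨by omega, h2⟩
      · rw [Function.update_of_ne (by omega), Function.update_of_ne (by omega)] at h1 h2
        refine Or.inr ⟨i, by omega, h1, ?_⟩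
        rwa [e _ (by omega)]

/-- The ideal obtained by adding `x_m ^ v m`, which makes the edge `{m, m + 1}` redundant. -/
theorem pathPred_or_le {v c : ℕ → ℕ} {m : ℕ} (h0 : 0 < v m) (t : ℕ → ℕ) :
    PathPred v (m + 1) c t ∨ v m ≤ t m ↔ PathPred v m (Function.update c m (v m)) t := by
  constructor
  · rintro ((⟨j, hj, h1, h2⟩ | ⟨i, hi, h1, h2⟩) | h)
    · rcases Nat.lt_succ_iff_lt_or_eq.mp hj with hj | rfl
      · exact Or.inl ⟨j, hj, h1, h2⟩
      · exact Or.inr ⟨j, le_rfl, by simpa using h0, by simpa using h1⟩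
    · refine Or.inr ⟨i, by omega, ?_⟩
      rw [Function.update_of_ne (by omega)]
      exact ⟨h1, h2⟩
    · exact Or.inr ⟨m, le_rfl, by simpa using h0, by simpa using h⟩
  · rintro (⟨j, hj, h⟩ | ⟨i, hi, h1, h2⟩)
    · exact Or.inl (Or.inl ⟨j, by omega, h⟩)
    · by_cases him : i = m
      · subst him
        exact Or.inr (by simpa using h2)
      · rw [Function.update_of_ne him] at h1 h2
        exact Or.inl (Or.inr ⟨i, by omega, h1, h2⟩)

/-- Adding `x_m ^ v m` to the path ideal keeps `V` avoided: raising the exponent of `x_{m + 1}` to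
at least `v m` turns a monomial outside `(I, x_m ^ v m)` into one outside `I`. -/
theorem Avoids.or_le {N : ℕ} {v c : ℕ → ℕ} {m : ℕ} {V : Finset (Fin N)}
    (h : Avoids (PathPred v (m + 1) c) V) (hc : c (m + 1) = 0 ∨ v m < c (m + 1)) :
    Avoids (fun t => PathPred v (m + 1) c t ∨ v m ≤ t m) V := by
  intro t ht
  push Not at ht
  obtain ⟨ht, htm⟩ := ht
  have hle : t ≤ Function.update t (m + 1) (max (t (m + 1)) (v m)) := by
    rw [Pi.le_def]
    intro j
    by_cases hj : j = m + 1
    · subst hj; simp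
    · simp [hj]
  obtain ⟨x, hx, hE⟩ := h (Function.update t (m + 1) (max (t (m + 1)) (v m))) (by
    rintro (⟨j, hj, h1, h2⟩ | ⟨i, hi, h1, h2⟩)
    · rw [Function.update_of_ne (by omega)] at h1
      by_cases hjm : j = m
      · subst hjm; omega
      · rw [Function.update_of_ne (by omega)] at h2
        exact ht (Or.inl ⟨j, hj, h1, h2⟩)
    · by_cases him : i = m + 1
      · subst him
        rw [Function.update_self] at h2
        refine ht (Or.inr ⟨m + 1, le_rfl, h1, ?_⟩)
        omega
      · rw [Function.update_of_ne him] at h2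
        exact ht (Or.inr ⟨i, hi, h1, h2⟩))
  refine ⟨x, hx, ?_⟩
  rintro (h | h)
  · exact hE (monotone_pathPred v _ c (add_le_add_left hle _) h)
  · refine hE (Or.inl ⟨m, by omega, ?_, ?_⟩)
    · simpa using h
    · simp only [Pi.add_apply, Function.update_self]
      omega

/-- Sums of variables over pairwise disjoint avoided sets form a weakly regular sequence modulo a
path ideal with increasing weights. -/
theorem isWeaklyRegular_pathPred {K : Type*} [Field K] {N : ℕ} {v : ℕ → ℕ}
    {l : List (Finset (Fin N))} (hl : l.Pairwise Disjoint) (m : ℕ) : ∀ c : ℕ → ℕ, m < N →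
    (∀ j < m, 0 < v j) → (∀ j, j + 1 < m → v j ≤ v (j + 1)) →
    (∀ V ∈ l, Avoids (PathPred v m c) V) →
    IsWeaklyRegular (MvPolynomial (Fin N) K ⧸
      monIdeal K N (PathPred v m c) (monotone_pathPred v m c)) (l.map (varSum K)) := by
  induction m using Nat.strong_induction_on with
  | _ m ih =>
  intro c hmN hpos hmono hV
  rcases m with _ | m
  · exact isWeaklyRegular_purePowers v hl _ c rfl fun V hVl => (hV V hVl).exists_eq_zero
  by_cases hc : c (m + 1) = 0 ∨ v m < c (m + 1)
  · have h2 := ih m (by omega) (Function.update c m (v m)) (by omega)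
      (fun j hj => hpos j (by omega)) (fun j hj => hmono j (by omega)) fun V hVl =>
        ((hV V hVl).or_le hc).congr (pathPred_or_le (hpos m (by omega)))
    rcases m with _ | m
    · refine isWeaklyRegular_monIdeal_of_split _ (⟨0, by omega⟩ : Fin N) (v 0) _ _
        (pathPred_one_add_single (hpos 0 (by omega)) hc) (pathPred_or_le (hpos 0 (by omega)))
        (ih 0 (by omega) _ (by omega) (by simp) (by simp) fun V hVl =>
          ((hV V hVl).add _).congr (pathPred_one_add_single (hpos 0 (by omega)) hc)) h2
    · have hsplit := pathPred_add_single (hmono m (by omega)) (hpos m (by omega))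
        (hpos (m + 1) (by omega)) hc
      refine isWeaklyRegular_monIdeal_of_split _ (⟨m + 1, by omega⟩ : Fin N) (v (m + 1))
        (monotone_pathPred _ _ _) _ hsplit (pathPred_or_le (hpos (m + 1) (by omega)))
        (ih m (by omega) _ (by omega) (fun j hj => hpos j (by omega))
          (fun j hj => hmono j (by omega)) fun V hVl =>
            ((hV V hVl).add _).congr hsplit) h2
  · have hiff := pathPred_succ_of_le (v := v) (c := c) (m := m) (by omega) (by omega)
    rw [monIdeal_congr _ (monotone_pathPred v m _) hiff]
    refine ih m (by omega) _ (by omega) (fun j hj => hpos j (by omega))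
      (fun j hj => hmono j (by omega)) fun V hVl => (hV V hVl).congr hiff

/-- An edge that divides `x_i x ^ t` but not `x ^ t` contains `i`, and its weight exceeds the
exponent of `x_i` by one. -/
theorem eq_of_pathPred_add_single {v t : ℕ → ℕ} {m i : ℕ} (ht : ¬ PathPred v m 0 t) :
    PathPred v m 0 (t + Pi.single i 1) → (i < m ∧ v i = t i + 1 ∧ v i ≤ t (i + 1)) ∨
      ∃ k, k + 1 = i ∧ k < m ∧ v k = t i + 1 ∧ v k ≤ t k := by
  rintro (⟨k, hk, h1, h2⟩ | ⟨k, -, h1, -⟩)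
  · have hnot : ¬ (v k ≤ t k ∧ v k ≤ t (k + 1)) := fun h => ht (Or.inl ⟨k, hk, h⟩)
    simp only [Pi.add_apply, Pi.single_apply] at h1 h2
    by_cases hki : k = i
    · subst hki
      rw [if_pos rfl] at h1
      rw [if_neg (by omega)] at h2
      left; omega
    · rw [if_neg hki] at h1
      by_cases hki' : k + 1 = i
      · rw [if_pos hki'] at h2
        subst hki'
        right
        exact ⟨k, rfl, hk, by omega, h1⟩
      · rw [if_neg hki'] at h2
        exact absurd ⟨by omega, by omega⟩ hnot
  · simp at h1

/-- If the edges `{j, j + 1}` and `{j + 1, j + 2}` have equal weight, then the vertices `j - 1`, `j`,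
`j + 1` (only the last two for `j = 0`) are avoided. The vertices `j`, `j + 1`, `j + 2` need not be,
since the next edge may be heavier. -/
theorem avoids_of_eq {N : ℕ} {v : ℕ → ℕ} {m j : ℕ} (hj : j + 1 < m) (heq : v j = v (j + 1))
    (hmono : ∀ i, i + 1 < m → v i ≤ v (i + 1)) {V : Finset (Fin N)}
    (hV : ∀ i, i ≤ j + 1 → j ≤ i + 1 → ∃ x ∈ V, (x : ℕ) = i) :
    Avoids (PathPred v m 0) V := by
  intro t ht
  by_contra! hall
  have hall' : ∀ i, i ≤ j + 1 → j ≤ i + 1 → PathPred v m 0 (t + Pi.single i 1) := by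
    intro i h1 h2
    obtain ⟨x, hx, rfl⟩ := hV i h1 h2
    exact hall x hx
  have key := fun i => eq_of_pathPred_add_single (i := i) ht
  have h1 := key (j + 1) (hall' _ (by omega) (by omega))
  have ht1 : t (j + 1) + 1 = v j := by
    rcases h1 with h | ⟨k, hk, -, h, -⟩
    · omega
    · obtain rfl : k = j := by omega
      omega
  rcases key j (hall' _ (by omega) (by omega)) with h | ⟨k, rfl, hk, h2, h3⟩
  · omega
  have := hmono k (by omega)
  rcases key k (hall' _ (by omega) (by omega)) with h | ⟨i, rfl, hi, h4, -⟩
  · omega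
  · have := hmono i (by omega)
    omega

/-- The two vertices of the last edge, which has the largest weight, are avoided. -/
theorem avoids_last {N : ℕ} {v : ℕ → ℕ} {m : ℕ}
    (hmono : ∀ i, i + 1 < m + 1 → v i ≤ v (i + 1)) {V : Finset (Fin N)}
    (hV : ∀ i, i ≤ m + 1 → m ≤ i → ∃ x ∈ V, (x : ℕ) = i) :
    Avoids (PathPred v (m + 1) 0) V := by
  intro t ht
  by_contra! hall
  have key := fun i => eq_of_pathPred_add_single (i := i) ht
  obtain ⟨x, hx, hxm⟩ := hV (m + 1) le_rfl (by omega)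
  obtain ⟨y, hy, hym⟩ := hV m (by omega) le_rfl
  rcases key (m + 1) (hxm ▸ hall x hx) with h | ⟨k, hk, -, h1, h2⟩
  · omega
  obtain rfl : k = m := by omega
  rcases key k (hym ▸ hall y hy) with h | ⟨i, rfl, hi, h3, -⟩
  · omega
  · have := hmono i (by omega)
    omega

/-! ### Packings, and associated primes of path ideals -/

/-- The greedy count from the right: the largest element `≤ j` of `T` is counted, and the two
numbers below it are skipped. It is the maximal number of elements `≤ j` of `T` with pairwise
distances at least `3`. -/
def greedyCount (T : Finset ℕ) : ℕ → ℕ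
  | 0 => 0
  | j + 1 => if j + 1 ∈ T then greedyCount T (j - 2) + 1 else greedyCount T j

theorem greedyCount_zero (T : Finset ℕ) : greedyCount T 0 = 0 := by rw [greedyCount]

theorem greedyCount_succ (T : Finset ℕ) (j : ℕ) : greedyCount T (j + 1) =
    if j + 1 ∈ T then greedyCount T (j - 2) + 1 else greedyCount T j := by rw [greedyCount]

/-- The greedy choice itself, as a decreasing list. -/
theorem exists_packing (T : Finset ℕ) (j : ℕ) : ∃ U : List ℕ,
    U.Pairwise (fun a b => b + 3 ≤ a) ∧ (∀ a ∈ U, a ∈ T ∧ 0 < a ∧ a ≤ j) ∧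
      U.length = greedyCount T j := by
  induction j using Nat.strong_induction_on with
  | _ j ih =>
  rcases j with _ | j
  · exact ⟨[], by simp, by simp, by simp [greedyCount_zero]⟩
  rw [greedyCount_succ]
  split_ifs with h
  · obtain ⟨U, h1, h2, h3⟩ := ih (j - 2) (by omega)
    rcases Nat.lt_or_ge j 2 with hj | hj
    · refine ⟨[j + 1], by simp, by simpa using h, ?_⟩
      rw [Nat.sub_eq_zero_of_le hj.le, greedyCount_zero]
      rfl
    · refine ⟨(j + 1) :: U, List.pairwise_cons.mpr ⟨fun a ha => ?_, h1⟩, ?_, by simp [h3]⟩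
      · have := (h2 a ha).2.2
        omega
      · intro a ha
        rcases List.mem_cons.mp ha with rfl | ha
        · exact ⟨h, by omega, le_rfl⟩
        · have := h2 a ha
          exact ⟨this.1, this.2.1, by omega⟩
  · obtain ⟨U, h1, h2, h3⟩ := ih j (by omega)
    exact ⟨U, h1, fun a ha => ⟨(h2 a ha).1, (h2 a ha).2.1, by have := (h2 a ha).2.2; omega⟩, h3⟩

/-- The monomial `x ^ u` witnesses that the ideal generated by the variables `x_i`, `i ∈ P`, is the
colon ideal by `x ^ u` of the monomial ideal given by `E` in the first `m` variables. -/
def IsColonWitness (E : (ℕ → ℕ) → Prop) (m : ℕ) (u : ℕ → ℕ) (P : Finset ℕ) : Prop :=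
  P ⊆ Finset.range m ∧ ∀ t : ℕ → ℕ, (∀ i < m, u i ≤ t i) → (E t ↔ ∃ i ∈ P, u i < t i)

/-- The exponent vectors of the monomials in the ideal of the path with vertices `0, …, m - 1`
together with the power `x_{m - 1} ^ v (m - 1)` of the variable of its last vertex. -/
def CapPred (v : ℕ → ℕ) (m : ℕ) (t : ℕ → ℕ) : Prop :=
  (∃ j, j + 1 < m ∧ v j ≤ t j ∧ v j ≤ t (j + 1)) ∨ (1 ≤ m ∧ v (m - 1) ≤ t (m - 1))

theorem pathPred_zero_iff {v : ℕ → ℕ} {m : ℕ} {t : ℕ → ℕ} :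
    PathPred v m 0 t ↔ ∃ j < m, v j ≤ t j ∧ v j ≤ t (j + 1) := by
  simp [PathPred]

/-- Adding one more variable, with exponent one less than its critical value, to a witness. -/
theorem IsColonWitness.insertVar {E E' : (ℕ → ℕ) → Prop} {m k : ℕ} {u : ℕ → ℕ} {P : Finset ℕ}
    (h : IsColonWitness E m u P) (hk : 0 < k)
    (hE : ∀ t : ℕ → ℕ, (∀ i < m, u i ≤ t i) → k - 1 ≤ t m → (E' t ↔ E t ∨ k ≤ t m)) :
    IsColonWitness E' (m + 1) (Function.update u m (k - 1)) (insert m P) := by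
  have hP : ∀ i ∈ P, i ≠ m := fun i hi => (Finset.mem_range.mp (h.1 hi)).ne
  refine ⟨?_, fun t ht => ?_⟩
  · intro i hi
    rcases Finset.mem_insert.mp hi with rfl | hi
    · simp
    · have := Finset.mem_range.mp (h.1 hi)
      exact Finset.mem_range.mpr (by omega)
  · have ht' : ∀ i < m, u i ≤ t i := fun i hi => by
      have := ht i (by omega)
      rwa [Function.update_of_ne hi.ne] at this
    have htm := ht m (by omega)
    rw [Function.update_self] at htm
    rw [hE t ht' htm, h.2 t ht', Finset.exists_mem_insert, Function.update_self, or_comm]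
    refine or_congr (by omega) (exists_congr fun i => and_congr_right fun hi => ?_)
    rw [Function.update_of_ne (hP i hi)]

/-- From a capped path on `m` vertices to the path with two more vertices: the first new variable
gets the exponent `v m` and stays free. -/
theorem IsColonWitness.path {v : ℕ → ℕ} {m : ℕ} {u : ℕ → ℕ} {P : Finset ℕ}
    (h : IsColonWitness (CapPred v m) m u P) (h0 : 0 < v m)
    (hmono : ∀ j, j + 1 = m → v j ≤ v m) :
    ∃ u', IsColonWitness (PathPred v (m + 1) 0) (m + 2) u' (insert (m + 1) P) := by
  have h1 : IsColonWitness (CapPred v m) (m + 1) (Function.update u m (v m)) P := by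
    refine ⟨fun i hi => ?_, fun t ht => ?_⟩
    · have := Finset.mem_range.mp (h.1 hi)
      exact Finset.mem_range.mpr (by omega)
    · rw [h.2 t fun i hi => by
        have := ht i (by omega)
        rwa [Function.update_of_ne hi.ne] at this]
      refine exists_congr fun i => and_congr_right fun hi => ?_
      rw [Function.update_of_ne (Finset.mem_range.mp (h.1 hi)).ne]
  refine ⟨_, h1.insertVar h0 fun t ht _ => ?_⟩
  have htm := ht m (by omega)
  rw [Function.update_self] at htm
  rw [pathPred_zero_iff]
  constructor
  · rintro ⟨j, hj, h2, h3⟩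
    rcases (by omega : j + 1 < m ∨ j + 1 = m ∨ j = m) with hj | rfl | rfl
    · exact Or.inl (Or.inl ⟨j, hj, h2, h3⟩)
    · exact Or.inl (Or.inr ⟨by omega, h2⟩)
    · exact Or.inr h3
  · rintro ((⟨j, hj, h2, h3⟩ | ⟨hm, h2⟩) | h2)
    · exact ⟨j, by omega, h2, h3⟩
    · have := hmono (m - 1) (by omega)
      refine ⟨m - 1, by omega, h2, ?_⟩
      rw [Nat.sub_add_cancel hm]
      omega
    · exact ⟨m, by omega, htm, h2⟩

/-- Following the greedy choice from the right end. If `v m = v (m + 1)`, the capped last vertex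
`m + 1` makes the edge `{m, m + 1}` redundant, which leaves an uncapped path ending at `m` with one
more free variable; otherwise the exponent `v (m + 1) - 1 ≥ v m` turns that edge into a cap at `m`. -/
theorem exists_isColonWitness_capPred {v : ℕ → ℕ} {M : ℕ} {T : Finset ℕ}
    (hpos : ∀ j < M, 0 < v j) (hmono : ∀ j, j + 1 < M → v j ≤ v (j + 1))
    (hT : ∀ j, j + 1 < M → (j + 1 ∈ T ↔ v j = v (j + 1))) (m : ℕ) : m ≤ M →
    ∃ u P, IsColonWitness (CapPred v m) m u P ∧ m ≤ P.card + greedyCount T (m - 1) := by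
  induction m using Nat.strong_induction_on with
  | _ m ih =>
  intro hmM
  have hcard : ∀ {E m u P}, IsColonWitness E m u P → (insert m P).card = P.card + 1 :=
    fun h => Finset.card_insert_of_notMem fun hm => by simpa using h.1 hm
  have h0 : ∀ m, IsColonWitness (fun _ => False) m 0 ∅ := fun m => ⟨by simp, by simp⟩
  rcases m with _ | _ | m
  · exact ⟨0, ∅, ⟨by simp, by simp [CapPred]⟩, by simp⟩
  · refine ⟨_, _, (h0 0).insertVar (hpos 0 (by omega)) fun t _ _ => ?_, ?_⟩
    · simp [CapPred]
    · rw [hcard (h0 0)]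
      simp
  by_cases heq : v m = v (m + 1)
  · have hE : ∀ t, CapPred v (m + 2) t ↔ PathPred v m 0 t ∨ v (m + 1) ≤ t (m + 1) := by
      intro t
      rw [pathPred_zero_iff]
      constructor
      · rintro (⟨j, hj, h1, h2⟩ | ⟨-, h⟩)
        · rcases (by omega : j < m ∨ j = m) with hj | rfl
          · exact Or.inl ⟨j, hj, h1, h2⟩
          · exact Or.inr (heq ▸ h2)
        · exact Or.inr h
      · rintro (⟨j, hj, h⟩ | h)
        · exact Or.inl ⟨j, by omega, h⟩
        · exact Or.inr ⟨by omega, h⟩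
    have hg : greedyCount T (m + 2 - 1) = greedyCount T (m - 2) + 1 := by
      rw [show m + 2 - 1 = m + 1 from rfl, greedyCount_succ, if_pos ((hT m (by omega)).mpr heq)]
    rw [hg]
    rcases m with _ | m
    · refine ⟨_, _, (h0 1).insertVar (hpos 1 (by omega)) fun t _ _ => (hE t).trans ?_, ?_⟩
      · simp [PathPred]
      · rw [hcard (h0 1), Finset.card_empty]
        omega
    · obtain ⟨u, P, hw, hc⟩ := ih m (by omega) (by omega)
      obtain ⟨u', hw'⟩ := hw.path (hpos m (by omega)) (fun j hj => hj ▸ hmono j (by omega))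
      refine ⟨_, _, hw'.insertVar (hpos (m + 2) (by omega)) fun t _ _ => hE t, ?_⟩
      rw [hcard hw', Finset.card_insert_of_notMem fun hm => by simpa using hw.1 hm,
        show m + 1 - 2 = m - 1 by omega]
      omega
  · have hlt : v m < v (m + 1) := lt_of_le_of_ne (hmono m (by omega)) heq
    obtain ⟨u, P, hw, hc⟩ := ih (m + 1) (by omega) (by omega)
    have hg : greedyCount T (m + 2 - 1) = greedyCount T m := by
      rw [show m + 2 - 1 = m + 1 from rfl, greedyCount_succ,
        if_neg fun h => heq ((hT m (by omega)).mp h)]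
    refine ⟨_, _, hw.insertVar (hpos (m + 1) (by omega)) fun t _ ht => ?_, ?_⟩
    · constructor
      · rintro (⟨j, hj, h1, h2⟩ | ⟨-, h⟩)
        · rcases (by omega : j < m ∨ j = m) with hj | rfl
          · exact Or.inl (Or.inl ⟨j, by omega, h1, h2⟩)
          · exact Or.inl (Or.inr ⟨by omega, h1⟩)
        · exact Or.inr h
      · rintro ((⟨j, hj, h⟩ | ⟨-, h⟩) | h)
        · exact Or.inl ⟨j, by omega, h⟩
        · exact Or.inl ⟨m, by omega, h, by omega⟩
        · exact Or.inr ⟨by omega, h⟩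
    · rw [hcard hw, hg]
      rw [Nat.add_sub_cancel] at hc
      omega

/-- The path ideal has an associated prime generated by variables whose quotient has dimension at
most one more than the greedy count. -/
theorem exists_isColonWitness_pathPred {v : ℕ → ℕ} {n : ℕ} {T : Finset ℕ}
    (hpos : ∀ j < n, 0 < v j) (hmono : ∀ j, j + 1 < n → v j ≤ v (j + 1))
    (hT : ∀ j, j + 2 < n → (j + 1 ∈ T ↔ v j = v (j + 1))) :
    ∃ u P, IsColonWitness (PathPred v n 0) (n + 1) u P ∧
      n + 1 ≤ P.card + (greedyCount T (n - 2) + 1) := by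
  rcases n with _ | n
  · exact ⟨0, ∅, ⟨by simp, by simp [PathPred]⟩, by simp⟩
  · obtain ⟨u, P, hw, hc⟩ := exists_isColonWitness_capPred (M := n) (T := T)
      (fun j hj => hpos j (by omega)) (fun j hj => hmono j (by omega))
      (fun j hj => hT j (by omega)) n le_rfl
    obtain ⟨u', hw'⟩ := hw.path (hpos n (by omega)) (fun j hj => hj ▸ hmono j (by omega))
    refine ⟨u', _, hw', ?_⟩
    rw [Finset.card_insert_of_notMem fun hm => by simpa using hw.1 hm,
      show n + 1 - 2 = n - 1 by omega]
    omega

/-! ### The combinatorics of blocks -/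

section Blocks

open BlockDecomposition

/-- The greedy count from the left on an increasing list: the first element that is at least `p` is
counted, and everything up to the second number above it is skipped. -/
def leftGreedyCount : ℕ → List ℕ → ℕ
  | _, [] => 0
  | p, x :: l => if x < p then leftGreedyCount p l else leftGreedyCount (x + 3) l + 1

/-- The state of the left greedy count after all numbers up to `j` have been read, in terms of the
right greedy count: `p` is the next number that may be counted. -/
def GreedyState (T : Finset ℕ) (j p : ℕ) : Prop :=
  (p ≤ j + 1 ∧ greedyCount T (j - 1) = greedyCount T j ∧
    greedyCount T (j - 2) = greedyCount T j) ∨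
  (p = j + 2 ∧ greedyCount T (j - 1) = greedyCount T j ∧
    greedyCount T (j - 2) + 1 = greedyCount T j) ∨
  (p = j + 3 ∧ greedyCount T (j - 1) + 1 = greedyCount T j ∧
    greedyCount T (j - 2) + 1 = greedyCount T j)

theorem greedyCount_add_eq (T : Finset ℕ) (d : ℕ) : ∀ (j p : ℕ) (l : List ℕ),
    l.Pairwise (· < ·) → (∀ x ∈ l, j < x) → (∀ x, x ∈ l ↔ x ∈ T ∧ j < x ∧ x ≤ j + d) →
    GreedyState T j p → greedyCount T (j + d) = greedyCount T j + leftGreedyCount p l := by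
  induction d with
  | zero =>
    intro j p l _ _ hmem _
    have : l = [] := List.eq_nil_iff_forall_not_mem.mpr fun x hx => by
      have := (hmem x).mp hx
      omega
    rw [this, leftGreedyCount, add_zero, add_zero]
  | succ d ih =>
    intro j p l hl hlt hmem hs
    have e : j + (d + 1) = j + 1 + d := by omega
    have hstep := greedyCount_succ T j
    have e1 : j + 1 - 1 = j := by omega
    have e2 : j + 1 - 2 = j - 1 := by omega
    by_cases hj : j + 1 ∈ T
    · rw [if_pos hj] at hstep
      obtain _ | ⟨y, l⟩ := l
      · have := (hmem (j + 1)).mpr ⟨hj, by omega, by omega⟩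
        simp at this
      have hy : y = j + 1 := by
        rcases List.mem_cons.mp ((hmem (j + 1)).mpr ⟨hj, by omega, by omega⟩) with h | h
        · exact h.symm
        · have h1 := List.rel_of_pairwise_cons hl h
          have h2 := hlt y (by simp)
          omega
      subst hy
      have hlt' : ∀ x ∈ l, j + 1 < x := fun x hx => List.rel_of_pairwise_cons hl hx
      have hmem' : ∀ x, x ∈ l ↔ x ∈ T ∧ j + 1 < x ∧ x ≤ j + 1 + d := by
        intro x
        constructor
        · intro hx
          have := (hmem x).mp (by simp [hx])
          exact ⟨this.1, hlt' x hx, by omega⟩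
        · rintro ⟨h1, h2, h3⟩
          rcases List.mem_cons.mp ((hmem x).mpr ⟨h1, by omega, by omega⟩) with h | h
          · omega
          · exact h
      have hih := fun q => ih (j + 1) q l (List.Pairwise.of_cons hl) hlt' hmem'
      rw [leftGreedyCount, e]
      split_ifs with hp
      · rw [hih p (by unfold GreedyState at hs ⊢; rw [e1, e2]; omega)]
        unfold GreedyState at hs
        omega
      · rw [hih (j + 1 + 3) (by unfold GreedyState at hs ⊢; rw [e1, e2]; omega)]
        unfold GreedyState at hs
        omega
    · rw [if_neg hj] at hstep
      have hlt' : ∀ x ∈ l, j + 1 < x := fun x hx => by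
        have h1 := (hmem x).mp hx
        have : x ≠ j + 1 := fun h => hj (h ▸ h1.1)
        omega
      rw [e, ih (j + 1) p l hl hlt' ?_ ?_, hstep]
      · intro x
        rw [hmem x]
        constructor
        · rintro ⟨h1, h2, h3⟩
          have : x ≠ j + 1 := fun h => hj (h ▸ h1)
          exact ⟨h1, by omega, by omega⟩
        · rintro ⟨h1, h2, h3⟩
          exact ⟨h1, by omega, by omega⟩
      · unfold GreedyState at hs ⊢
        rw [e1, e2]
        omega

theorem greedyCount_eq_leftGreedyCount {T : Finset ℕ} {N : ℕ} (hT : ∀ x ∈ T, 0 < x ∧ x ≤ N) :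
    greedyCount T N = leftGreedyCount 0 (T.sort (· ≤ ·)) := by
  have := greedyCount_add_eq T N 0 0 (T.sort (· ≤ ·)) T.sortedLT_sort.pairwise
    (fun x hx => (hT x (by simpa using hx)).1) (fun x => by
      rw [Finset.mem_sort]
      exact ⟨fun h => ⟨h, (hT x h).1, by simpa using (hT x h).2⟩, fun h => h.1⟩)
    (Or.inl ⟨by omega, rfl, rfl⟩)
  rwa [zero_add, greedyCount_zero, zero_add] at this

/-- A nonempty list of consecutive integers. -/
def IsInterval (δ : List ℕ) : Prop := 0 < δ.length ∧ δ = List.range' (δ.headD 0) δ.length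

theorem leftGreedyCount_range' (L : ℕ) : ∀ (x : ℕ) (R : List ℕ),
    leftGreedyCount x (List.range' x L ++ R) =
      (L + 2) / 3 + leftGreedyCount (x + 3 * ((L + 2) / 3)) R := by
  induction L using Nat.strong_induction_on with
  | _ L ih =>
  intro x R
  rcases L with _ | _ | _ | L
  · simp
  · simp [List.range'_succ, leftGreedyCount]
    omega
  · simp [List.range'_succ, leftGreedyCount]
    omega
  · have h := ih L (by omega) (x + 3) R
    simp only [List.range'_succ, List.cons_append, leftGreedyCount]
    rw [if_neg (by omega), if_pos (by omega), if_pos (by omega), show x + 1 + 1 + 1 = x + 3 by omega,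
      h, show (L + 1 + 1 + 1 + 2) / 3 = (L + 2) / 3 + 1 by omega,
      show x + 3 * ((L + 2) / 3 + 1) = x + 3 + 3 * ((L + 2) / 3) by omega]
    omega

/-- The greedy count on an interval of length `L`, when counting may begin at its first element
(`s = 0`) or only at the second one (`s = 1`). -/
theorem IsInterval.leftGreedyCount_append {δ : List ℕ} (hδ : IsInterval δ) {s p : ℕ}
    (h : s = 0 ∧ p ≤ δ.headD 0 ∨ s = 1 ∧ p = δ.headD 0 + 1) (R : List ℕ) :
    leftGreedyCount p (δ ++ R) = (δ.length - s + 2) / 3 +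
      leftGreedyCount (δ.headD 0 + s + 3 * ((δ.length - s + 2) / 3)) R := by
  obtain ⟨h0, hδ⟩ := hδ
  generalize δ.headD 0 = x at *
  generalize δ.length = L at *
  obtain ⟨L, rfl⟩ : ∃ L', L = L' + 1 := ⟨L - 1, by omega⟩
  subst hδ
  rcases h with ⟨rfl, hp⟩ | ⟨rfl, rfl⟩
  · rw [← leftGreedyCount_range', Nat.sub_zero, add_zero, List.range'_succ, List.cons_append,
      leftGreedyCount, leftGreedyCount, if_neg (by omega), if_neg (by omega)]
  · rw [List.range'_succ, List.cons_append, leftGreedyCount, if_pos (by omega),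
      leftGreedyCount_range', Nat.add_sub_cancel]

theorem IsInterval.getLastD_eq {δ : List ℕ} (hδ : IsInterval δ) :
    δ.getLastD 0 + 1 = δ.headD 0 + δ.length := by
  obtain ⟨h0, hδ⟩ := hδ
  generalize δ.headD 0 = x at *
  generalize δ.length = L at *
  subst hδ
  obtain ⟨L, rfl⟩ : ∃ L', L = L' + 1 := ⟨L - 1, by omega⟩
  rw [List.range'_concat, List.getLastD_concat]
  omega

theorem isInterval_of_isChain {δ : List ℕ} (h0 : δ ≠ [])
    (h : δ.IsChain fun x y => decide (y = x + 1)) : IsInterval δ := by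
  refine ⟨List.length_pos_iff.mpr h0, ?_⟩
  induction δ with
  | nil => exact absurd rfl h0
  | cons x l ih =>
    rw [List.isChain_cons] at h
    rcases l with _ | ⟨y, l⟩
    · rfl
    · have h1 := ih (by simp) h.2
      have h2 : y = x + 1 := by simpa using h.1
      subst h2
      rw [List.length_cons, List.range'_succ]
      exact congrArg (x :: ·) h1

/-- The sum of the integer parts of a third of the lengths of the blocks. -/
def sumThirds (D : List (List ℕ)) : ℕ := (D.map fun δ => δ.length / 3).sum

theorem numType_cons (j : ℕ) (δ : List ℕ) (D : List (List ℕ)) :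
    numType j (δ :: D) = numType j D + if δ.length % 3 = j then 1 else 0 := by
  rw [numType, List.countP_cons, ← numType]
  simp only [decide_eq_true_eq]
  rfl

theorem numType_nil (j : ℕ) : numType j [] = 0 := rfl

theorem sumThirds_cons (δ : List ℕ) (D : List (List ℕ)) :
    sumThirds (δ :: D) = δ.length / 3 + sumThirds D := rfl

theorem sumThirds_nil : sumThirds [] = 0 := rfl

/-- The greedy count on a run of gluable blocks: the blocks of type `1` alternately enlarge the count
and restore the initial state. -/
theorem leftGreedyCount_run (D : List (List ℕ)) : ∀ (δ : List ℕ) (s p : ℕ),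
    (∀ ε ∈ δ :: D, IsInterval ε ∧ blockType ε ≠ 0) → (δ :: D).IsChain Gluable →
    (s = 0 ∧ p ≤ δ.headD 0 ∨ s = 1 ∧ p = δ.headD 0 + 1) →
    ∃ p', p' ≤ ((δ :: D).getLast (List.cons_ne_nil _ _)).getLastD 0 + 3 ∧
      ∀ R, leftGreedyCount p ((δ :: D).flatten ++ R) = sumThirds (δ :: D) + numType 2 (δ :: D) +
        (numType 1 (δ :: D) + 1 - s) / 2 + leftGreedyCount p' R := by
  induction D with
  | nil =>
    intro δ s p hI _ hs
    obtain ⟨hδ, ht⟩ := hI δ (by simp)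
    have h0 := hδ.1
    have hlast := hδ.getLastD_eq
    unfold blockType at ht
    refine ⟨δ.headD 0 + s + 3 * ((δ.length - s + 2) / 3), ?_, fun R => ?_⟩
    · rw [List.getLast_singleton]
      omega
    · rw [List.flatten_singleton, hδ.leftGreedyCount_append hs]
      rw [numType_cons, numType_cons, numType_nil, numType_nil, sumThirds_cons, sumThirds_nil]
      split_ifs <;> omega
  | cons ε D ih =>
    intro δ s p hI hch hs
    obtain ⟨hδ, ht⟩ := hI δ (by simp)
    have h0 := hδ.1
    have hlast := hδ.getLastD_eq
    rw [List.isChain_cons_cons] at hch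
    have hg := hch.1.2.2
    unfold blockType at ht
    obtain ⟨p', hp', hR⟩ := ih ε (if δ.length % 3 = 1 then 1 - s else s)
      (δ.headD 0 + s + 3 * ((δ.length - s + 2) / 3)) (fun η hη => hI η (by simp_all)) hch.2
      (by split_ifs <;> omega)
    refine ⟨p', ?_, fun R => ?_⟩
    · rwa [List.getLast_cons (List.cons_ne_nil _ _)]
    · rw [List.flatten_cons, List.append_assoc, hδ.leftGreedyCount_append hs, hR, ← add_assoc]
      congr 1
      rw [numType_cons _ δ, numType_cons _ δ, sumThirds_cons δ]
      split_ifs <;> omega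

/-- The contribution of a piece to the greedy count. -/
def pieceCount (D : List (List ℕ)) : ℕ := sumThirds D + numType 2 D + (numType 1 D + 1) / 2

theorem blockType_ne_zero_of_isChain (D : List (List ℕ)) : ∀ δ : List ℕ, blockType δ ≠ 0 →
    (δ :: D).IsChain Gluable → ∀ ε ∈ δ :: D, blockType ε ≠ 0 := by
  induction D with
  | nil =>
    intro δ ht _ ε hε
    rwa [List.mem_singleton.mp hε]
  | cons η D ih =>
    intro δ ht hch ε hε
    rw [List.isChain_cons_cons] at hch
    rcases List.mem_cons.mp hε with rfl | hε
    · exact ht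
    · exact ih η hch.1.2.1 hch.2 ε hε

/-- The greedy count is additive over the pieces: it enters each piece of blocks of nonzero type at
its first element, and on a block of type `0` it does not matter whether the first element has to be
skipped. -/
theorem leftGreedyCount_pieces (P : List (List (List ℕ))) : ∀ p,
    (∀ D ∈ P, D ≠ [] ∧ D.IsChain Gluable ∧ ∀ δ ∈ D, IsInterval δ) →
    P.flatten.IsChain (fun δ ε => δ.getLastD 0 + 2 ≤ ε.headD 0) →
    P.IsChain (fun D D' => ∃ h h', ¬ Gluable (D.getLast h) (D'.head h')) →
    (∀ δ ∈ P.flatten.head?, p ≤ δ.headD 0 ∨ blockType δ = 0 ∧ p ≤ δ.headD 0 + 1) →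
    leftGreedyCount p P.flatten.flatten = (P.map pieceCount).sum := by
  induction P with
  | nil =>
    intro p _ _ _ _
    rfl
  | cons D P ih =>
    intro p hD hsep hglue hp
    obtain ⟨hne, hch, hI⟩ := hD D (by simp)
    obtain ⟨δ, D, rfl⟩ := List.exists_cons_of_ne_nil hne
    have hp' := hp δ (by simp)
    have hδ := hI δ (by simp)
    have h0 := hδ.1
    have hlast := hδ.getLastD_eq
    rw [List.flatten_cons, List.isChain_append] at hsep
    rw [List.isChain_cons] at hglue
    -- reading the first piece leaves the count in a state `q` that the next piece may start from
    suffices h : ∃ q, (∀ R, leftGreedyCount p ((δ :: D).flatten ++ R) =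
        pieceCount (δ :: D) + leftGreedyCount q R) ∧
        ∀ ε ∈ P.flatten.head?, q ≤ ε.headD 0 ∨ blockType ε = 0 ∧ q ≤ ε.headD 0 + 1 by
      obtain ⟨q, hq, hq'⟩ := h
      rw [List.flatten_cons, List.flatten_append, hq, List.map_cons, List.sum_cons,
        ih q (fun D' hD' => hD D' (by simp [hD'])) hsep.2.1 hglue.2 hq']
    have hsep' : ∀ ε ∈ P.flatten.head?,
        ((δ :: D).getLast (List.cons_ne_nil _ _)).getLastD 0 + 2 ≤ ε.headD 0 := fun ε hε =>
      hsep.2.2 _ (by rw [List.getLast?_eq_getLast_of_ne_nil (List.cons_ne_nil _ _)]; rfl) ε hε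
    by_cases ht : blockType δ = 0
    · have hD : D = [] := by
        rcases D with _ | ⟨ε, D⟩
        · rfl
        · exact absurd ht (List.isChain_cons_cons.mp hch).1.1
      subst hD
      unfold blockType at ht
      rw [List.getLast_singleton] at hsep'
      obtain ⟨s, hs1, hs⟩ : ∃ s, s ≤ 1 ∧
          (s = 0 ∧ p ≤ δ.headD 0 ∨ s = 1 ∧ p = δ.headD 0 + 1) := by
        rcases Nat.lt_or_ge (δ.headD 0) p with h | h
        · exact ⟨1, le_rfl, Or.inr ⟨rfl, by omega⟩⟩
        · exact ⟨0, by omega, Or.inl ⟨rfl, h⟩⟩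
      refine ⟨δ.headD 0 + s + 3 * ((δ.length - s + 2) / 3), fun R => ?_, fun ε hε => Or.inl ?_⟩
      · rw [List.flatten_singleton, hδ.leftGreedyCount_append hs]
        rw [pieceCount, numType_cons, numType_cons, numType_nil, numType_nil, sumThirds_cons,
          sumThirds_nil]
        split_ifs <;> omega
      · have := hsep' ε hε
        omega
    · have hall : ∀ ε ∈ δ :: D, IsInterval ε ∧ blockType ε ≠ 0 := by
        exact fun ε hε => ⟨hI ε hε, blockType_ne_zero_of_isChain D δ ht hch ε hε⟩
      obtain ⟨q, hq, hR⟩ := leftGreedyCount_run D δ 0 p hall hch (Or.inl ⟨rfl, by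
        rcases hp' with h | h
        · exact h
        · exact absurd h.1 ht⟩)
      refine ⟨q, hR, fun ε hε => ?_⟩
      have h1 := hsep' ε hε
      by_cases hε0 : blockType ε = 0
      · exact Or.inr ⟨hε0, by omega⟩
      left
      rcases P with _ | ⟨D', P⟩
      · simp at hε
      obtain ⟨h, h', hng⟩ := hglue.1 D' rfl
      obtain ⟨ε', D', rfl⟩ := List.exists_cons_of_ne_nil h'
      obtain rfl : ε' = ε := by simpa using hε
      -- the two pieces are not glued, and both blocks have nonzero type
      have : ε'.headD 0 ≠ ((δ :: D).getLast (List.cons_ne_nil _ _)).getLastD 0 + 2 := fun he =>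
        hng ⟨(hall _ (List.getLast_mem _)).2, hε0, he⟩
      omega

theorem k_eq_sum_pieceCount (T : Finset ℕ) : k T = ((pieces T).map pieceCount).sum := by
  have hcard : (pieces T).flatten.flatten.length = T.card := by
    simp [pieces, blocks, List.flatten_splitBy]
  have key := a_add_two_b_add_three_c T
  have hD : ∀ D : List (List ℕ), D.flatten.length =
      numType 1 D + 2 * numType 2 D + 3 * sumThirds D := by
    intro D
    induction D with
    | nil => rfl
    | cons δ D ih =>
      rw [numType_cons, numType_cons, sumThirds_cons, List.flatten_cons, List.length_append]
      split_ifs <;> omega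
  have total : ∀ P : List (List (List ℕ)),
      3 * ((P.map residue).sum + ((P.map (numType 2)).sum +
        (P.map fun D => (numType 1 D - residue D) / 2).sum)) + P.flatten.flatten.length =
      3 * (P.map pieceCount).sum + ((P.map residue).sum + 2 * ((P.map (numType 2)).sum +
        (P.map fun D => (numType 1 D - residue D) / 2).sum)) := by
    intro P
    induction P with
    | nil => rfl
    | cons D P ih =>
      simp only [List.map_cons, List.sum_cons, List.flatten_cons, List.flatten_append,
        List.length_append] at ih ⊢
      have h1 : residue D = numType 1 D % 2 := rfl
      have h2 : pieceCount D = sumThirds D + numType 2 D + (numType 1 D + 1) / 2 := rfl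
      have h3 := hD D
      omega
  have h := total (pieces T)
  rw [hcard] at h
  have ha : a T = ((pieces T).map residue).sum := rfl
  have hb : b T = ((pieces T).map (numType 2)).sum +
    ((pieces T).map fun D => (numType 1 D - residue D) / 2).sum := rfl
  rw [← hb, ← ha] at h
  unfold k
  omega

theorem k_eq_leftGreedyCount (T : Finset ℕ) : k T = leftGreedyCount 0 (T.sort (· ≤ ·)) := by
  have hflat : (pieces T).flatten.flatten = T.sort (· ≤ ·) := by
    simp [pieces, blocks, List.flatten_splitBy]
  have hflat' : (pieces T).flatten = blocks T := by simp [pieces, List.flatten_splitBy]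
  have hint : ∀ δ ∈ blocks T, IsInterval δ := fun δ hδ =>
    isInterval_of_isChain (List.ne_nil_of_mem_splitBy hδ) (List.isChain_of_mem_splitBy hδ)
  rw [k_eq_sum_pieceCount, ← hflat, eq_comm]
  refine leftGreedyCount_pieces _ 0 (fun D hD => ⟨List.ne_nil_of_mem_splitBy hD, ?_, ?_⟩) ?_ ?_ ?_
  · exact (List.isChain_of_mem_splitBy hD).imp fun δ ε h => by simpa using h
  · exact fun δ hδ => hint δ (hflat' ▸ List.mem_flatten_of_mem hD hδ)
  · rw [hflat']
    have h1 : (blocks T).Pairwise fun δ ε => ∀ x ∈ δ, ∀ y ∈ ε, x < y := by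
      have : (blocks T).flatten.Pairwise (· < ·) := by
        rw [blocks, List.flatten_splitBy]
        exact T.sortedLT_sort.pairwise
      exact (List.pairwise_flatten.mp this).2
    have h2 : (blocks T).IsChain fun δ ε => ∃ ha hb,
        decide (ε.head hb = δ.getLast ha + 1) = false :=
      List.isChain_getLast_head_splitBy (fun x y => decide (y = x + 1)) (T.sort (· ≤ ·))
    have h1' := h1.isChain
    rw [List.isChain_iff_getElem] at h1' ⊢
    rw [List.isChain_iff_getElem] at h2
    intro i hi
    obtain ⟨ha, hb, h3⟩ := h2 i hi
    have h4 := h1' i hi _ (List.getLast_mem ha) _ (List.head_mem hb)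
    rw [decide_eq_false_iff_not] at h3
    have e1 : ∀ (l : List ℕ) (h : l ≠ []), l.getLastD 0 = l.getLast h := fun l h => by
      rw [List.getLastD_eq_getLast?, List.getLast?_eq_getLast_of_ne_nil h]; rfl
    have e2 : ∀ (l : List ℕ) (h : l ≠ []), l.headD 0 = l.head h := fun l h => by
      rw [List.headD_eq_head?_getD, List.head?_eq_some_head h]; rfl
    rw [e1 _ ha, e2 _ hb]
    exact Nat.lt_of_le_of_ne (Nat.succ_le_of_lt h4) (fun h => h3 h.symm)
  · refine (List.isChain_getLast_head_splitBy _ (blocks T)).imp fun D D' ⟨h, h', h3⟩ => ⟨h, h', ?_⟩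
    simpa using h3
  · exact fun δ _ => Or.inl (Nat.zero_le _)

theorem k_eq_greedyCount {T : Finset ℕ} {N : ℕ} (hT : ∀ x ∈ T, 0 < x ∧ x ≤ N) :
    k T = greedyCount T N := by
  rw [k_eq_leftGreedyCount, greedyCount_eq_leftGreedyCount hT]

end Blocks

/-! ### The depth of a path ideal -/

theorem pathEdgeIdeal_eq_monIdeal (K : Type*) [Field K] (n : ℕ) (w : ℕ → ℕ) :
    pathEdgeIdeal K n w = monIdeal K (n + 1) (PathPred (fun j => w (j + 1)) n 0)
      (monotone_pathPred _ n 0) := by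
  have hgen : ∀ j : Fin n, (X j.castSucc * X j.succ : MvPolynomial (Fin (n + 1)) K) ^ w (j + 1) =
      monomial (Finsupp.single j.castSucc (w (j + 1)) + Finsupp.single j.succ (w (j + 1))) 1 := by
    intro j
    rw [mul_pow, X_pow_eq_monomial, X_pow_eq_monomial, monomial_mul, one_mul]
  have hne : ∀ j : Fin n, j.castSucc ≠ j.succ := fun j => j.castSucc_lt_succ.ne
  have hset : pathEdgeIdeal K n w = Ideal.span ((fun s => monomial s (1 : K)) ''
      Set.range fun j : Fin n =>
        Finsupp.single j.castSucc (w (j + 1)) + Finsupp.single j.succ (w (j + 1))) := by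
    rw [pathEdgeIdeal, ← Set.range_comp]
    exact congrArg (fun f => Ideal.span (Set.range f)) (funext hgen)
  ext p
  rw [hset, mem_ideal_span_monomial_image, mem_monIdeal]
  refine forall₂_congr fun s _ => ?_
  rw [pathPred_zero_iff]
  constructor
  · rintro ⟨_, ⟨j, rfl⟩, hle⟩
    refine ⟨j, j.2, ?_, ?_⟩
    · have := hle j.castSucc
      rw [Finsupp.add_apply, Finsupp.single_eq_same] at this
      rw [← Fin.val_castSucc, extendExp_apply]
      exact (Nat.le_add_right _ _).trans this
    · have := hle j.succ
      rw [Finsupp.add_apply, Finsupp.single_eq_same] at this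
      rw [← Fin.val_succ, extendExp_apply]
      exact (Nat.le_add_left _ _).trans this
  · rintro ⟨j, hj, h1, h2⟩
    refine ⟨_, ⟨⟨j, hj⟩, rfl⟩, fun i => ?_⟩
    have e1 := extendExp_apply s (Fin.castSucc ⟨j, hj⟩)
    have e2 := extendExp_apply s (Fin.succ ⟨j, hj⟩)
    simp only [Fin.val_castSucc, Fin.val_succ] at e1 e2
    rw [e1] at h1
    rw [e2] at h2
    by_cases hi1 : i = Fin.castSucc ⟨j, hj⟩
    · subst hi1
      simpa [(hne ⟨j, hj⟩).symm] using h1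
    · by_cases hi2 : i = Fin.succ ⟨j, hj⟩
      · subst hi2
        simpa [hne ⟨j, hj⟩] using h2
      · rw [Finsupp.add_apply, Finsupp.single_eq_of_ne hi1, Finsupp.single_eq_of_ne hi2]
        exact Nat.zero_le _

theorem gradedMaximalIdeal_eq (K : Type*) [Field K] (m : ℕ) :
    gradedMaximalIdeal K m = Ideal.span (X '' (Set.univ : Set (Fin m))) := by
  rw [gradedMaximalIdeal, Set.image_univ]

/-- A colon ideal generated by variables is an associated prime, so the number of the remaining
variables bounds the length of every regular sequence. -/
theorem length_le_of_isColonWitness {K : Type*} [Field K] {N : ℕ} {E : (ℕ → ℕ) → Prop}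
    (hE : Monotone E) {u : ℕ → ℕ} {P : Finset ℕ} (hw : IsColonWitness E N u P)
    {rs : List (MvPolynomial (Fin N) K)} (hmem : ∀ r ∈ rs, r ∈ gradedMaximalIdeal K N)
    (hreg : IsWeaklyRegular (MvPolynomial (Fin N) K ⧸ monIdeal K N E hE) rs) :
    rs.length + P.card ≤ N := by
  classical
  let C : Finset (Fin N) := Finset.univ.filter fun i => (i : ℕ) ∈ P
  have hCP : C.card = P.card := by
    rw [← Finset.card_map Fin.valEmbedding]
    congr 1
    ext i
    simp only [C, Finset.mem_map, Finset.mem_filter, Finset.mem_univ, true_and,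
      Fin.valEmbedding_apply]
    exact ⟨fun ⟨a, ha, h⟩ => h ▸ ha, fun hi => ⟨⟨i, Finset.mem_range.mp (hw.1 hi)⟩, hi, rfl⟩⟩
  let s : Fin N →₀ ℕ := Finsupp.equivFunOnFinite.symm fun i => u i
  have hs : ∀ i : Fin N, s i = u i := fun i => rfl
  set I := monIdeal K N E hE with hI
  have hcolon : (⊥ : Submodule (MvPolynomial (Fin N) K) (MvPolynomial (Fin N) K ⧸ I)).colon
      {Ideal.Quotient.mk I (monomial s 1)} =
      Ideal.span (X '' (C : Set (Fin N)) : Set (MvPolynomial (Fin N) K)) := by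
    ext p
    rw [Submodule.mem_colon_singleton, Submodule.mem_bot,
      show p • Ideal.Quotient.mk I (monomial s 1) = Ideal.Quotient.mk I (p * monomial s 1) from rfl,
      Ideal.Quotient.eq_zero_iff_mem, mul_comm, monomial_mul_mem_monIdeal,
      ← monIdeal_eq_span_X (monotone_pred_add hE (extendExp s)) (C : Set (Fin N))]
    intro t
    have hle : ∀ i < N, u i ≤ (extendExp t + extendExp s) i := by
      intro i hi
      have := extendExp_apply s ⟨i, hi⟩
      rw [hs] at this
      rw [Pi.add_apply]
      exact this ▸ Nat.le_add_left _ _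
    rw [hw.2 _ hle]
    constructor
    · rintro ⟨i, hi, h⟩
      have hiN := Finset.mem_range.mp (hw.1 hi)
      refine ⟨⟨i, hiN⟩, by simpa [C] using hi, ?_⟩
      have h1 := extendExp_apply s ⟨i, hiN⟩
      have h2 := extendExp_apply t ⟨i, hiN⟩
      rw [hs] at h1
      rw [Pi.add_apply] at h
      simp only at h1 h2
      omega
    · rintro ⟨i, hi, h⟩
      refine ⟨i, by simpa [C] using hi, ?_⟩
      rw [Pi.add_apply, extendExp_apply, extendExp_apply, hs]
      omega
  have hass : IsAssociatedPrime (Ideal.span (X '' (C : Set (Fin N)) :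
      Set (MvPolynomial (Fin N) K))) (MvPolynomial (Fin N) K ⧸ I) :=
    isAssociatedPrime_iff.mpr ⟨isPrime_span_X_image _, _, hcolon.symm⟩
  have : (gradedMaximalIdeal K N).IsPrime := by
    rw [gradedMaximalIdeal_eq]
    exact isPrime_span_X_image _
  have h := (length_le_ringKrullDim_quotient (m := gradedMaximalIdeal K N) hass
    (Ideal.span_mono (Set.image_subset_range _ _)) hmem hreg).trans
    (ringKrullDim_quotient_span_X_image_le C)
  have h' : rs.length ≤ N - C.card := by exact_mod_cast h
  have : C.card ≤ N := by simpa using C.card_le_univ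
  omega

/-- For a proper monomial ideal, a weakly regular sequence of sums of variables is a regular sequence
in the graded maximal ideal. -/
theorem isRegular_varSum {K : Type*} [Field K] {N : ℕ} {E : (ℕ → ℕ) → Prop}
    (hE : Monotone E) (hE0 : ¬ E 0) {l : List (Finset (Fin N))}
    (h : IsWeaklyRegular (MvPolynomial (Fin N) K ⧸ monIdeal K N E hE) (l.map (varSum K))) :
    (∀ r ∈ l.map (varSum K), r ∈ gradedMaximalIdeal K N) ∧
      IsRegular (MvPolynomial (Fin N) K ⧸ monIdeal K N E hE) (l.map (varSum K)) := by
  have hmem : ∀ r ∈ l.map (varSum K), r ∈ gradedMaximalIdeal K N := by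
    intro r hr
    obtain ⟨V, -, rfl⟩ := List.mem_map.mp hr
    exact Ideal.sum_mem _ fun i _ => Ideal.subset_span ⟨i, rfl⟩
  refine ⟨hmem, (isRegular_iff _ _).mpr ⟨h, fun htop => ?_⟩⟩
  have hm : gradedMaximalIdeal K N ≠ ⊤ := by
    rw [gradedMaximalIdeal_eq]
    exact (isPrime_span_X_image _).ne_top
  have hle : monIdeal K N E hE ≤ gradedMaximalIdeal K N := by
    intro p hp
    rw [gradedMaximalIdeal_eq, mem_ideal_span_X_image]
    intro s hs
    by_contra! hs0
    have : s = 0 := by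
      ext i
      simpa using hs0 i trivial
    subst this
    apply hE0
    have := hp hs
    have e : extendExp (0 : Fin N →₀ ℕ) = 0 := by
      ext i
      simp [extendExp]
    rwa [← e]
  apply hm
  rw [Ideal.eq_top_iff_one, ← Ideal.Quotient.eq_zero_iff_mem]
  have h1 : (Ideal.Quotient.mk (monIdeal K N E hE) 1) ∈
      Submodule.map (monIdeal K N E hE).mkQ (gradedMaximalIdeal K N) := by
    have : (Ideal.ofList (l.map (varSum K)) • ⊤ :
        Submodule (MvPolynomial (Fin N) K) (MvPolynomial (Fin N) K ⧸ monIdeal K N E hE)) ≤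
        Submodule.map (monIdeal K N E hE).mkQ (gradedMaximalIdeal K N) := by
      rw [Submodule.smul_le]
      intro r hr x _
      obtain ⟨y, rfl⟩ := Submodule.mkQ_surjective _ x
      exact ⟨r • y, Ideal.mul_mem_right _ _ (Ideal.span_le.mpr hmem hr), map_smul _ _ _⟩
    exact this (htop ▸ trivial)
  obtain ⟨y, hy, h2⟩ := h1
  have h3 : y - 1 ∈ monIdeal K N E hE := (Submodule.Quotient.eq _).mp h2
  rw [Ideal.Quotient.eq_zero_iff_mem]
  have := Ideal.sub_mem _ hy (hle h3)
  rwa [sub_sub_cancel] at this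

/-- The vertices `j - 1`, `j`, `j + 1`, as far as they exist, of the path with vertices
`0, …, N - 1`. In particular `window (n + 1) n` is the set of the vertices of the last edge. -/
def window (N j : ℕ) : Finset (Fin N) :=
  Finset.univ.filter fun x => (x : ℕ) ≤ j + 1 ∧ j ≤ x + 1

theorem mem_window {N j : ℕ} {x : Fin N} : x ∈ window N j ↔ (x : ℕ) ≤ j + 1 ∧ j ≤ x + 1 := by
  simp [window]

theorem disjoint_window {N i j : ℕ} (h : i + 3 ≤ j) : Disjoint (window N j) (window N i) := by
  rw [Finset.disjoint_left]
  intro x hx hx'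
  rw [mem_window] at hx hx'
  omega

/-- A path ideal with increasing weights has a regular sequence whose length is one more than the
greedy count: one element for each member of a maximal packing, and one for the last edge. -/
theorem exists_isRegular_pathPred (K : Type*) [Field K] {n : ℕ} {v : ℕ → ℕ} {T : Finset ℕ}
    (hpos : ∀ j < n, 0 < v j) (hmono : ∀ j, j + 1 < n → v j ≤ v (j + 1))
    (hT : ∀ j, j + 2 < n → j + 1 ∈ T → v j = v (j + 1)) :
    ∃ rs : List (MvPolynomial (Fin (n + 1)) K), rs.length = greedyCount T (n - 2) + 1 ∧
      (∀ r ∈ rs, r ∈ gradedMaximalIdeal K (n + 1)) ∧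
      IsRegular (MvPolynomial (Fin (n + 1)) K ⧸
        monIdeal K (n + 1) (PathPred v n 0) (monotone_pathPred v n 0)) rs := by
  obtain ⟨U, hU1, hU2, hU3⟩ := exists_packing T (n - 2)
  let l : List (Finset (Fin (n + 1))) := window (n + 1) n :: U.map fun a => window (n + 1) (a - 1)
  have hl : l.Pairwise Disjoint := by
    refine List.pairwise_cons.mpr ⟨fun V hV => ?_, List.pairwise_map.mpr ?_⟩
    · obtain ⟨a, ha, rfl⟩ := List.mem_map.mp hV
      have := hU2 a ha
      exact disjoint_window (by omega)
    · refine hU1.imp_of_mem fun {a b} ha hb h => disjoint_window ?_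
      have := hU2 b hb
      omega
  have hwin : ∀ j i, i < n + 1 → i ≤ j + 1 → j ≤ i + 1 → ∃ x ∈ window (n + 1) j, (x : ℕ) = i :=
    fun j i hi h1 h2 => ⟨⟨i, hi⟩, mem_window.mpr ⟨h1, h2⟩, rfl⟩
  have havoid : ∀ V ∈ l, Avoids (PathPred v n 0) V := by
    intro V hV
    rcases List.mem_cons.mp hV with rfl | hV
    · rcases n with _ | m
      · intro t _
        exact ⟨0, mem_window.mpr ⟨by simp, by simp⟩, by simp [PathPred]⟩
      · exact avoids_last hmono fun i h1 h2 => hwin _ _ (by omega) (by omega) (by omega)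
    · obtain ⟨a, ha, rfl⟩ := List.mem_map.mp hV
      obtain ⟨haT, ha0, han⟩ := hU2 a ha
      refine avoids_of_eq (j := a - 1) (by omega) (hT _ (by omega) ?_) hmono
        fun i h1 h2 => hwin _ _ (by omega) h1 h2
      rwa [Nat.sub_add_cancel ha0]
  refine ⟨l.map (varSum K), by simp [l, hU3], isRegular_varSum _ ?_
    (isWeaklyRegular_pathPred hl n 0 (by omega) hpos hmono havoid)⟩
  rw [pathPred_zero_iff]
  rintro ⟨j, hj, h, -⟩
  exact absurd (hpos j hj) (by simpa using h)

theorem theorem3 {K : Type*} [Field K] (n : ℕ) (w : ℕ → ℕ)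
    (w_pos : ∀ i, 1 ≤ i → i ≤ n → 0 < w i)
    (w_increasing : ∀ i, 1 ≤ i → i + 1 ≤ n → w i ≤ w (i + 1)) :
    depthAt (gradedMaximalIdeal K (n + 1))
        (MvPolynomial (Fin (n + 1)) K ⧸ pathEdgeIdeal K n w) =
      ((BlockDecomposition.k (pathDelta n w) + 1 : ℕ) : ℕ∞) := by
  have hpos : ∀ j < n, 0 < w (j + 1) := fun j hj => w_pos _ (by omega) (by omega)
  have hmono : ∀ j, j + 1 < n → w (j + 1) ≤ w (j + 1 + 1) := fun j hj =>
    w_increasing _ (by omega) (by omega)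
  have hT : ∀ j, j + 2 < n → (j + 1 ∈ pathDelta n w ↔ w (j + 1) = w (j + 1 + 1)) := by
    intro j hj
    rw [pathDelta, Finset.mem_filter, Finset.mem_Icc]
    exact ⟨fun h => h.2, fun h => ⟨⟨by omega, by omega⟩, h⟩⟩
  rw [k_eq_greedyCount (N := n - 2) fun x hx => by
    have := (Finset.mem_Icc.mp (Finset.mem_filter.mp hx).1)
    exact ⟨by omega, by omega⟩, pathEdgeIdeal_eq_monIdeal]
  apply le_antisymm
  · refine iSup_le fun ⟨rs, hmem, hreg⟩ => ?_
    obtain ⟨u, P, hw, hP⟩ := exists_isColonWitness_pathPred hpos hmono hT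
    have := length_le_of_isColonWitness (monotone_pathPred _ n 0) hw hmem hreg.toIsWeaklyRegular
    exact Nat.cast_le.mpr (by dsimp only; omega)
  · obtain ⟨rs, hlen, hmem, hreg⟩ := exists_isRegular_pathPred K (v := fun j => w (j + 1))
      (T := pathDelta n w) hpos hmono fun j hj h => (hT j hj).mp h
    exact le_iSup_of_le ⟨rs, hmem, hreg⟩ (by rw [hlen])
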